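/- Let $R>0$, $0<m\le M$ and $K_1,K_2,L\ge 0$, and let $B_R(0)\subset\mathbb{R}^2$ be the open disc of radius $R$ centred at the origin. There is a constant $C>0$, depending only on $m,M,R,K_1,K_2,L$, such that the following holds. Let $u\in C^4(B_R(0))$ be a convex solution of the two-dimensional prescribed Gauss curvature equation $$\frac{\det\nabla^2u}{(1+|\nabla u|^2)^2}=f(x)\quad\text{in } B_R(0),$$ where $m\le f\le M$ in $B_R(0)$, and suppose that $\sup_{B_R(0)}|\nabla f|\le K_1$, $\sup_{B_R(0)}|\nabla^2f|\le K_2$ and $\sup_{B_R(0)}|\nabla u|\le L$. Then $$|\nabla^2u(0)|\le C.$$ Here $|\nabla^2 u|$ and $|\nabla^2 f|$ denote the Euclidean (Frobenius) norm of the Hessian matrix. -/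

import Mathlib

/-- The Hessian matrix `(∂ᵢ∂ⱼ u (x))` of a function on the Euclidean plane. -/
noncomputable def hessian (u : EuclideanSpace ℝ (Fin 2) → ℝ) (x : EuclideanSpace ℝ (Fin 2)) :
    Matrix (Fin 2) (Fin 2) ℝ :=
  Matrix.of fun i j =>
    fderiv ℝ (fderiv ℝ u) x (EuclideanSpace.single i 1) (EuclideanSpace.single j 1)

/-- The Euclidean (Frobenius) norm `|∇²u(x)|` of the Hessian matrix. -/
noncomputable def hessianNorm (u : EuclideanSpace ℝ (Fin 2) → ℝ) (x : EuclideanSpace ℝ (Fin 2)) :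
    ℝ :=
  Real.sqrt (∑ i, ∑ j, hessian u x i j ^ 2)

/-- `u` solves the prescribed Gauss curvature equation
`det ∇²u / (1 + |∇u|²)² = f` in the open disc `B_R(0)` of the plane. -/
def SolvesGaussCurvatureEq (u f : EuclideanSpace ℝ (Fin 2) → ℝ) (R : ℝ) : Prop :=
  ∀ x ∈ Metric.ball (0 : EuclideanSpace ℝ (Fin 2)) R,
    (hessian u x).det / (1 + ‖gradient u x‖ ^ 2) ^ 2 = f x

/-! The proof applies the maximum principle to log Δu + 8 log η + (K/2)(1 + |∇u|²) on a disc of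
radius √2 r, where r = R/2. In an eigenframe of ∇²u with eigenvalues A ≥ D the linearised operator
is D∂₁₁ + A∂₂₂, corrected by the transport term -4f(1+|∇u|²)∇u·∇ that comes from the gradient
dependence of the right-hand side. If A is large, only ∂₂ matters to leading order.

A radial cutoff fails: where x₂ is near 0 and |x| is near the radius, η₂₂/η tends to -∞ while η₂/η
stays small, so nothing compensates. The product (r² - x₁²)(r² - x₂²) in the eigenframe does not
have this defect: η₂₂/η = -2/(r² - x₂²) blows up only where η₂/η does too. There criticality forces
u₁₁₂/A ≈ -8 η₂/η, and the good term (u₁₁₂/A)² produced by log Δu wins, because 8² dominates 8. This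
is `cutoff_concavity`.

The eigenframe varies with the point, so the product is replaced by the frame-independent η = r⁴ -
r²|x|² + q², with the twist q = ⟨∇²u x, x^⊥⟩/Δu. In the eigenframe q = -x₁x₂(A - D)/(A + D), so η is
the product up to O(1/A²). Moreover |q| ≤ |x|²/2, so η ≤ 0 on |x|² = 2r² (`twist_sq_le`). Since q
contains ∇²u, Lη contains fourth derivatives of u, but only through L applied to second derivatives,
which the twice differentiated equation controls.

The third derivatives are not bounded a priori. Dividing by w² = 1 + (u₁₁₁/A²)² + (u₁₁₂/A)² puts
them on a unit sphere, and all remainders become continuous functions of bounded data carrying a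
factor 1/A. `PointData.exists_threshold` shows that 1/A ≤ δη contradicts maximality,
`CritJet.exists_bound` turns this into Aη ≤ T, and comparing the maximum with the value at 0 gives
the estimate. -/

/-- The normalised data of the maximum principle at a point where the Hessian is diagonal: the
position, the gradient of `u`, the 2-jet of `f`, the radius of the cutoff, and the rescaled
second and third derivatives of `u`. -/
structure PointData where
  /-- first coordinate -/
  x₁ : ℝ
  /-- second coordinate -/
  x₂ : ℝ
  /-- first derivative of `u` in the first direction -/
  u₁ : ℝ
  /-- first derivative of `u` in the second direction -/
  u₂ : ℝ
  /-- the prescribed curvature -/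
  f : ℝ
  /-- first derivative of `f` -/
  f₁ : ℝ
  /-- first derivative of `f` -/
  f₂ : ℝ
  /-- second derivative of `f` -/
  f₁₁ : ℝ
  /-- second derivative of `f` -/
  f₁₂ : ℝ
  /-- second derivative of `f` -/
  f₂₂ : ℝ
  /-- size of the cutoff -/
  r : ℝ
  /-- inverse of the large eigenvalue -/
  ε : ℝ
  /-- ratio of the large eigenvalue and the trace -/
  ρ : ℝ
  /-- normalising factor of the third derivatives -/
  ω : ℝ
  /-- normalised `u₁₁₁` -/
  α : ℝ
  /-- normalised `u₁₁₂` -/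
  b : ℝ

/-! ### Boundedness calculus on boxes of data -/

namespace PointData

/-- All entries are bounded by `Λ`. -/
structure InBox (Λ : ℝ) (d : PointData) : Prop where
  x₁ : |d.x₁| ≤ Λ
  x₂ : |d.x₂| ≤ Λ
  u₁ : |d.u₁| ≤ Λ
  u₂ : |d.u₂| ≤ Λ
  f : |d.f| ≤ Λ
  f₁ : |d.f₁| ≤ Λ
  f₂ : |d.f₂| ≤ Λ
  f₁₁ : |d.f₁₁| ≤ Λ
  f₁₂ : |d.f₁₂| ≤ Λ
  f₂₂ : |d.f₂₂| ≤ Λ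
  r : |d.r| ≤ Λ
  ε : |d.ε| ≤ Λ
  ρ : |d.ρ| ≤ Λ
  ω : |d.ω| ≤ Λ
  α : |d.α| ≤ Λ
  b : |d.b| ≤ Λ

/-- A quantity that is bounded on every box of data. -/
@[fun_prop]
def UnifBdd (X : PointData → ℝ) : Prop := ∀ Λ, ∃ C, ∀ d : PointData, d.InBox Λ → |X d| ≤ C

-- These closure rules let `fun_prop` bound any polynomial in the data, so remainder constants never
-- have to be computed.
@[fun_prop]
lemma UnifBdd.add {X Y : PointData → ℝ} (hX : UnifBdd X) (hY : UnifBdd Y) :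
    UnifBdd fun d => X d + Y d := fun Λ => by
  obtain ⟨C, hC⟩ := hX Λ
  obtain ⟨C', hC'⟩ := hY Λ
  exact ⟨C + C', fun d hd => (abs_add_le _ _).trans (add_le_add (hC d hd) (hC' d hd))⟩

@[fun_prop]
lemma UnifBdd.sub {X Y : PointData → ℝ} (hX : UnifBdd X) (hY : UnifBdd Y) :
    UnifBdd fun d => X d - Y d := fun Λ => by
  obtain ⟨C, hC⟩ := hX Λ
  obtain ⟨C', hC'⟩ := hY Λ
  exact ⟨C + C', fun d hd => (abs_sub _ _).trans (add_le_add (hC d hd) (hC' d hd))⟩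

@[fun_prop]
lemma UnifBdd.neg {X : PointData → ℝ} (hX : UnifBdd X) : UnifBdd fun d => -X d := fun Λ => by
  obtain ⟨C, hC⟩ := hX Λ
  exact ⟨C, fun d hd => by rw [abs_neg]; exact hC d hd⟩

@[fun_prop]
lemma UnifBdd.mul {X Y : PointData → ℝ} (hX : UnifBdd X) (hY : UnifBdd Y) :
    UnifBdd fun d => X d * Y d := fun Λ => by
  obtain ⟨C, hC⟩ := hX Λ
  obtain ⟨C', hC'⟩ := hY Λ
  refine ⟨C * C', fun d hd => ?_⟩
  rw [abs_mul]
  exact mul_le_mul (hC d hd) (hC' d hd) (abs_nonneg _) ((abs_nonneg _).trans (hC d hd))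

@[fun_prop]
lemma UnifBdd.pow {X : PointData → ℝ} (hX : UnifBdd X) (n : ℕ) :
    UnifBdd fun d => X d ^ n := fun Λ => by
  obtain ⟨C, hC⟩ := hX Λ
  refine ⟨C ^ n, fun d hd => ?_⟩
  rw [abs_pow]
  exact pow_le_pow_left₀ (abs_nonneg _) (hC d hd) n

@[fun_prop]
lemma UnifBdd.const (c : ℝ) : UnifBdd fun _ => c := fun _ => ⟨|c|, fun _ _ => le_rfl⟩

@[fun_prop]
lemma unifBdd_x₁ : UnifBdd x₁ := fun Λ => ⟨Λ, fun _ hd => hd.x₁⟩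
@[fun_prop]
lemma unifBdd_x₂ : UnifBdd x₂ := fun Λ => ⟨Λ, fun _ hd => hd.x₂⟩
@[fun_prop]
lemma unifBdd_u₁ : UnifBdd u₁ := fun Λ => ⟨Λ, fun _ hd => hd.u₁⟩
@[fun_prop]
lemma unifBdd_u₂ : UnifBdd u₂ := fun Λ => ⟨Λ, fun _ hd => hd.u₂⟩
@[fun_prop]
lemma unifBdd_f : UnifBdd f := fun Λ => ⟨Λ, fun _ hd => hd.f⟩
@[fun_prop]
lemma unifBdd_f₁ : UnifBdd f₁ := fun Λ => ⟨Λ, fun _ hd => hd.f₁⟩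
@[fun_prop]
lemma unifBdd_f₂ : UnifBdd f₂ := fun Λ => ⟨Λ, fun _ hd => hd.f₂⟩
@[fun_prop]
lemma unifBdd_f₁₁ : UnifBdd f₁₁ := fun Λ => ⟨Λ, fun _ hd => hd.f₁₁⟩
@[fun_prop]
lemma unifBdd_f₁₂ : UnifBdd f₁₂ := fun Λ => ⟨Λ, fun _ hd => hd.f₁₂⟩
@[fun_prop]
lemma unifBdd_f₂₂ : UnifBdd f₂₂ := fun Λ => ⟨Λ, fun _ hd => hd.f₂₂⟩
@[fun_prop]
lemma unifBdd_r : UnifBdd r := fun Λ => ⟨Λ, fun _ hd => hd.r⟩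
@[fun_prop]
lemma unifBdd_ε : UnifBdd ε := fun Λ => ⟨Λ, fun _ hd => hd.ε⟩
@[fun_prop]
lemma unifBdd_ρ : UnifBdd ρ := fun Λ => ⟨Λ, fun _ hd => hd.ρ⟩
@[fun_prop]
lemma unifBdd_ω : UnifBdd ω := fun Λ => ⟨Λ, fun _ hd => hd.ω⟩
@[fun_prop]
lemma unifBdd_α : UnifBdd α := fun Λ => ⟨Λ, fun _ hd => hd.α⟩
@[fun_prop]
lemma unifBdd_b : UnifBdd b := fun Λ => ⟨Λ, fun _ hd => hd.b⟩

/-! ### Normalised quantities at the maximum point -/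

/-- `1 + |∇u|²`. -/
def W (d : PointData) : ℝ := 1 + d.u₁ ^ 2 + d.u₂ ^ 2

/-- The determinant of the Hessian. -/
def F (d : PointData) : ℝ := d.f * d.W ^ 2

/-- The first derivative of the determinant in the first direction, times `ε`. -/
def φ₁ (d : PointData) : ℝ := d.ε * d.f₁ * d.W ^ 2 + 4 * d.f * d.W * d.u₁

/-- The first derivative of the determinant in the second direction. -/
def φ₂ (d : PointData) : ℝ := d.f₂ * d.W ^ 2 + 4 * d.f * d.W * d.u₂ * (d.F * d.ε)

/-- Normalised `u₁₂₂`. -/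
def t (d : PointData) : ℝ := d.φ₁ * d.ω - d.F * d.α

/-- Normalised `u₂₂₂`. -/
def s (d : PointData) : ℝ := d.φ₂ * d.ω - d.F * d.b

/-- Normalised defect `q + x₁x₂`, where `q` is the twist. -/
def E (d : PointData) : ℝ := 2 * d.x₁ * d.x₂ * d.F * d.ρ

/-- Normalised first derivative of the defect in the first direction. -/
def E₁ (d : PointData) : ℝ :=
  d.ρ * ((d.x₁ ^ 2 - d.x₂ ^ 2) * d.b + 2 * d.x₁ * d.x₂ * d.ε * d.t
    + 2 * d.x₂ * d.F * d.ε ^ 2 * d.ω - d.ε * d.E * (d.α + d.ε ^ 2 * d.t))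

/-- Normalised first derivative of the defect in the second direction. -/
def E₂ (d : PointData) : ℝ :=
  d.ρ * ((d.x₁ ^ 2 - d.x₂ ^ 2) * d.t + 2 * d.x₁ * d.x₂ * d.ε * d.s
    + 2 * d.x₁ * d.F * d.ε * d.ω - d.ε * d.E * (d.b + d.ε ^ 2 * d.s))

/-- Normalised second derivative of the determinant in the second direction. -/
def F₂₂ (d : PointData) : ℝ :=
  d.ω ^ 2 * (d.f₂₂ * d.W ^ 2 + 8 * d.f₂ * d.W * d.u₂ * (d.F * d.ε)
      + 8 * d.f * d.u₂ ^ 2 * (d.F * d.ε) ^ 2 + 4 * d.f * d.W * (d.F * d.ε) ^ 2)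
    + 4 * d.f * d.W * d.ω * (d.u₁ * d.t + d.u₂ * d.ε * d.s)

/-- Normalised second derivative of the determinant in the first direction. -/
def F₁₁ (d : PointData) : ℝ :=
  d.ω ^ 2 * (d.ε ^ 2 * d.f₁₁ * d.W ^ 2 + 8 * d.ε * d.f₁ * d.W * d.u₁
      + 8 * d.f * d.u₁ ^ 2 + 4 * d.f * d.W)
    + 4 * d.f * d.W * d.ω * (d.u₁ * d.α + d.u₂ * d.ε * d.b)

/-- Normalised mixed second derivative of the determinant. -/
def F₁₂ (d : PointData) : ℝ :=
  d.ω ^ 2 * (d.ε * d.f₁₂ * d.W ^ 2 + 4 * d.W * (d.f₁ * d.u₂ * d.F * d.ε ^ 2 + d.f₂ * d.u₁)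
      + 8 * d.f * d.u₁ * d.u₂ * d.F * d.ε)
    + 4 * d.f * d.W * d.ω * (d.u₁ * d.b + d.u₂ * d.ε * d.t)

/-- The linearised operator applied to the defect, normalised. -/
def LE (d : PointData) : ℝ :=
  d.ρ * ((d.x₁ ^ 2 - d.x₂ ^ 2) * (d.F₁₂ + d.b * d.t - d.α * d.s)
    + 2 * d.x₁ * d.x₂ * d.ε * (d.F₂₂ + 2 * (d.t ^ 2 - d.b * d.s))
    + 4 * d.F * d.ε * d.ω * (d.x₁ * d.b + d.ε * d.x₂ * d.t)
    + 4 * d.ω * (d.ε * d.x₁ * d.s - d.x₂ * d.t)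
    - 2 * (d.F * d.E₁ * (d.α + d.ε ^ 2 * d.t) + d.E₂ * (d.b + d.ε ^ 2 * d.s))
    - d.ε * d.E * (d.F₁₁ + d.ε ^ 2 * d.F₂₂
        + 2 * (d.b ^ 2 - d.α * d.t + d.ε ^ 2 * (d.t ^ 2 - d.b * d.s))))

/-- The twist. -/
def q (d : PointData) : ℝ := d.ε ^ 2 * d.E - d.x₁ * d.x₂

/-- The cutoff. -/
def η (d : PointData) : ℝ := d.r ^ 4 - d.r ^ 2 * (d.x₁ ^ 2 + d.x₂ ^ 2) + d.q ^ 2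

/-- Normalised derivative of the cutoff in the first direction. -/
def η₁ (d : PointData) : ℝ := -2 * d.r ^ 2 * d.x₁ * d.ω + 2 * d.q * (d.E₁ - d.x₂ * d.ω)

/-- Normalised derivative of the cutoff in the second direction. -/
def η₂ (d : PointData) : ℝ := -2 * d.r ^ 2 * d.x₂ * d.ω + 2 * d.q * (d.ε * d.E₂ - d.x₁ * d.ω)

/-- The linearised operator applied to the cutoff, normalised. -/
def Lη (d : PointData) : ℝ :=
  -2 * d.r ^ 2 * d.ω ^ 2 * (1 + d.F * d.ε ^ 2) + 2 * d.q * (d.ε * d.LE)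
    + 2 * d.F * d.ε ^ 2 * (d.E₁ - d.x₂ * d.ω) ^ 2 + 2 * (d.ε * d.E₂ - d.x₁ * d.ω) ^ 2

/-- The part of the linearised operator on `log Δu` that comes from the 2-jet of `f`. -/
def g (d : PointData) : ℝ :=
  d.ρ * (d.ε ^ 2 * d.W ^ 2 * (d.f₁₁ + d.f₂₂) + 8 * d.W * (d.f₁ * d.u₁ * d.ε
      + d.f₂ * d.u₂ * d.F * d.ε ^ 3) + 8 * d.f * (d.u₁ ^ 2 + d.u₂ ^ 2 * d.F ^ 2 * d.ε ^ 4)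
    + 4 * d.f * d.W * (1 + d.F ^ 2 * d.ε ^ 4))

/-- The linearised operator, corrected by a transport term, on `log Δu`, normalised. -/
def LlogS (d : PointData) : ℝ :=
  d.ω ^ 2 * d.g
    + 2 * d.ρ * (d.b ^ 2 + d.F * d.α ^ 2 - d.φ₁ * d.ω * d.α + d.ε ^ 2 * (d.t ^ 2 - d.b * d.s))
    - d.ρ ^ 2 * (d.F * (d.α + d.ε ^ 2 * d.t) ^ 2 + (d.b + d.ε ^ 2 * d.s) ^ 2)

/-- Remainder in the expansion of `LlogS`. -/
def gRem (d : PointData) : ℝ :=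
  d.ε * (2 * (d.t ^ 2 - d.b * d.s)
    - 2 * d.F * d.ρ * (d.b ^ 2 + d.F * d.α ^ 2 - d.φ₁ * d.ω * d.α
        + d.ε ^ 2 * (d.t ^ 2 - d.b * d.s))
    + d.F * d.ρ * (1 + d.ρ) * (d.F * (d.α + d.ε ^ 2 * d.t) ^ 2 + (d.b + d.ε ^ 2 * d.s) ^ 2)
    - (2 * d.F * d.α * d.t + d.F * d.ε ^ 2 * d.t ^ 2 + 2 * d.b * d.s + d.ε ^ 2 * d.s ^ 2))

/-- The hypothesis gives `ρ = 1 - F ε² ρ`, so to leading order the expression is twice the first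
bracket minus the squared gradient of the trace. This leaves one copy of `b² + F α²`, the coercive
part of the whole argument. -/
lemma LlogS_eq (d : PointData) (h : d.ρ * (1 + d.F * d.ε ^ 2) = 1) :
    d.LlogS = d.ω ^ 2 * d.g + d.b ^ 2 + d.F * d.α ^ 2 - 2 * d.φ₁ * d.ω * d.α + d.ε * d.gRem := by
  have h' : d.ρ = 1 - d.F * d.ε ^ 2 * d.ρ := by linear_combination h
  set X := d.b ^ 2 + d.F * d.α ^ 2 - d.φ₁ * d.ω * d.α + d.ε ^ 2 * (d.t ^ 2 - d.b * d.s) with hX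
  set Y := d.F * (d.α + d.ε ^ 2 * d.t) ^ 2 + (d.b + d.ε ^ 2 * d.s) ^ 2 with hY
  simp only [LlogS, gRem, ← hX, ← hY]
  have : 2 * d.ρ * X - d.ρ ^ 2 * Y
      = 2 * X - Y - 2 * d.F * d.ε ^ 2 * d.ρ * X + d.F * d.ε ^ 2 * d.ρ * (1 + d.ρ) * Y := by
    linear_combination (2 * X - (1 + d.ρ) * Y) * h'
  rw [add_sub_assoc, this, hX, hY]
  ring

@[fun_prop]
lemma unifBdd_W : UnifBdd W := by unfold W; fun_prop

@[fun_prop]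
lemma unifBdd_F : UnifBdd F := by unfold F; fun_prop

@[fun_prop]
lemma unifBdd_φ₁ : UnifBdd φ₁ := by unfold φ₁; fun_prop

@[fun_prop]
lemma unifBdd_φ₂ : UnifBdd φ₂ := by unfold φ₂; fun_prop

@[fun_prop]
lemma unifBdd_t : UnifBdd t := by unfold t; fun_prop

@[fun_prop]
lemma unifBdd_s : UnifBdd s := by unfold s; fun_prop

@[fun_prop]
lemma unifBdd_E : UnifBdd E := by unfold E; fun_prop

@[fun_prop]
lemma unifBdd_E₁ : UnifBdd E₁ := by unfold E₁; fun_prop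

@[fun_prop]
lemma unifBdd_E₂ : UnifBdd E₂ := by unfold E₂; fun_prop

@[fun_prop]
lemma unifBdd_F₂₂ : UnifBdd F₂₂ := by unfold F₂₂; fun_prop

@[fun_prop]
lemma unifBdd_F₁₁ : UnifBdd F₁₁ := by unfold F₁₁; fun_prop

@[fun_prop]
lemma unifBdd_F₁₂ : UnifBdd F₁₂ := by unfold F₁₂; fun_prop

@[fun_prop]
lemma unifBdd_LE : UnifBdd LE := by unfold LE; fun_prop

@[fun_prop]
lemma unifBdd_q : UnifBdd q := by unfold q; fun_prop

@[fun_prop]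
lemma unifBdd_η₁ : UnifBdd η₁ := by unfold η₁; fun_prop

@[fun_prop]
lemma unifBdd_η₂ : UnifBdd η₂ := by unfold η₂; fun_prop

@[fun_prop]
lemma unifBdd_g : UnifBdd g := by unfold g; fun_prop

@[fun_prop]
lemma unifBdd_gRem : UnifBdd gRem := by unfold gRem; fun_prop

end PointData

/-! ### The normalised maximum principle inequality -/

namespace PointData

lemma UnifBdd.exists_pos {X : PointData → ℝ} (hX : UnifBdd X) (Λ : ℝ) :
    ∃ C, 0 < C ∧ ∀ d : PointData, d.InBox Λ → |X d| ≤ C := by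
  obtain ⟨C, hC⟩ := hX Λ
  exact ⟨max C 1, by positivity, fun d hd => (hC d hd).trans (le_max_left _ _)⟩

/-- The cutoff is concave in the second direction only where its logarithmic derivative is
large, up to a bounded error. -/
lemma cutoff_concavity {r x y₁ y₂ η : ℝ} (hr : 0 < r) (hη : 0 < η) (hy₁ : 0 < y₁)
    (hy : y₂ = r ^ 2 - x ^ 2) (h₁ : η / 2 ≤ y₁ * y₂) (h₂ : y₁ * y₂ ≤ 2 * η) :
    -(64 / r ^ 2) ≤ 32 * x ^ 2 * (y₁ / η) ^ 2 - 16 * (y₁ / η) := by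
  set Y := y₁ / η with hY
  have hYη : Y * η = y₁ := by rw [hY]; field_simp
  have hY0 : 0 < Y := by positivity
  have hr2 : 0 < r ^ 2 := by positivity
  have a₁ : 1 / 2 ≤ Y * y₂ := by
    have : η * (1 / 2) ≤ η * (Y * y₂) := by rw [← hYη] at h₁; linarith
    exact le_of_mul_le_mul_left this hη
  have a₂ : Y * y₂ ≤ 2 := by
    have : η * (Y * y₂) ≤ η * 2 := by rw [← hYη] at h₂; linarith
    exact le_of_mul_le_mul_left this hη
  -- Here `Y` is comparable to `1 / y₂`. If `x² ≥ r²/2` then `y₂ ≤ r²/2` and `2x²Y ≥ 1`, so the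
  -- square dominates; otherwise `y₂ ≥ r²/2` and `Y ≤ 4/r²`.
  rcases le_total (r ^ 2 / 2) (x ^ 2) with h | h
  · have hYr : 1 ≤ Y * r ^ 2 := by
      have : Y * y₂ ≤ Y * (r ^ 2 / 2) := mul_le_mul_of_nonneg_left (by linarith) hY0.le
      linarith
    have h3 : 0 ≤ Y * (2 * x ^ 2 * Y - 1) := by
      refine mul_nonneg hY0.le ?_
      have : Y * (r ^ 2 / 2) ≤ Y * x ^ 2 := mul_le_mul_of_nonneg_left h hY0.le
      linarith
    have : 0 ≤ 64 / r ^ 2 := by positivity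
    nlinarith
  · have hYr : Y * (r ^ 2 / 2) ≤ 2 :=
      (mul_le_mul_of_nonneg_left (by linarith) hY0.le).trans a₂
    have : Y ≤ 4 / r ^ 2 := by rw [le_div_iff₀ hr2]; linarith
    have h4 : 64 / r ^ 2 = 16 * (4 / r ^ 2) := by ring
    have : 0 ≤ 32 * x ^ 2 * Y ^ 2 := by positivity
    linarith

/-- The cross term `-2 φ₁ ω α` is absorbed by completing the square with half of `m α²`. The
resulting loss is a multiple of `ω²`, which the gradient term of the test function will pay for. -/
lemma LlogS_lower (Λ : ℝ) {m : ℝ} (hm : 0 < m) :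
    ∃ C, 0 < C ∧ ∀ d : PointData, d.InBox Λ → m ≤ d.F → 0 < d.ε →
      d.ρ * (1 + d.F * d.ε ^ 2) = 1 →
      d.b ^ 2 + m / 2 * d.α ^ 2 - C * d.ω ^ 2 - C * d.ε ≤ d.LlogS := by
  obtain ⟨C₁, h₁, H₁⟩ := unifBdd_g.exists_pos Λ
  obtain ⟨C₂, h₂, H₂⟩ := unifBdd_φ₁.exists_pos Λ
  obtain ⟨C₃, h₃, H₃⟩ := unifBdd_gRem.exists_pos Λ
  refine ⟨C₁ + 2 * C₂ ^ 2 / m + C₃, by positivity, fun d hd hF hε hρ => ?_⟩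
  rw [LlogS_eq d hρ]
  have e₁ := mul_le_mul_of_nonneg_left (abs_le.1 (H₁ d hd)).1 (sq_nonneg d.ω)
  have e₃ := mul_le_mul_of_nonneg_left (abs_le.1 (H₃ d hd)).1 hε.le
  have e₂ : d.φ₁ ^ 2 ≤ C₂ ^ 2 := sq_le_sq' (abs_le.1 (H₂ d hd)).1 (abs_le.1 (H₂ d hd)).2
  have e₄ : 0 ≤ m / 2 * (d.α - 2 / m * (d.φ₁ * d.ω)) ^ 2 := by positivity
  have e₅ : m / 2 * (d.α - 2 / m * (d.φ₁ * d.ω)) ^ 2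
      = m / 2 * d.α ^ 2 - 2 * d.φ₁ * d.ω * d.α + 2 * d.φ₁ ^ 2 / m * d.ω ^ 2 := by
    field_simp; ring
  have e₆ : 2 * d.φ₁ ^ 2 / m * d.ω ^ 2 ≤ 2 * C₂ ^ 2 / m * d.ω ^ 2 := by gcongr
  have e₇ := mul_le_mul_of_nonneg_right hF (sq_nonneg d.α)
  have e₈ : 0 ≤ (C₁ + 2 * C₂ ^ 2 / m) * d.ε := by positivity
  have e₉ : 0 ≤ C₃ * d.ω ^ 2 := by positivity
  linarith

lemma half_sq_sub_sq_le (p q : ℝ) : p ^ 2 / 2 - q ^ 2 ≤ (p + q) ^ 2 := by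
  linarith [sq_nonneg (p + 2 * q)]

/-- The factor 8 is the exponent of the cutoff; three quarters of 8² survive the error `e`. -/
lemma three_quarters_sq_le (z e : ℝ) : 48 * z ^ 2 - 3 * e ^ 2 ≤ (-8 * z + e) ^ 2 := by
  linarith [sq_nonneg (4 * z - 2 * e)]

set_option maxHeartbeats 1000000 in
/-- The maximum principle inequality in normalised form. -/
theorem exists_threshold (Λ m r : ℝ) (hm : 0 < m) (hr : 0 < r) :
    ∃ K, 0 < K ∧ ∃ δ, 0 < δ ∧ ∀ d : PointData, d.InBox Λ → d.r = r → m ≤ d.F → 0 < d.ε →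
      d.ρ * (1 + d.F * d.ε ^ 2) = 1 → d.ω ^ 2 + d.α ^ 2 + d.b ^ 2 = 1 →
      d.x₁ ^ 2 + d.x₂ ^ 2 ≤ 2 * r ^ 2 → 0 < d.η → d.η ≤ r ^ 4 → d.ε ≤ δ * d.η →
      d.ρ * (d.b + d.ε ^ 2 * d.s) + 8 * (d.η₂ / d.η) + K * d.u₂ * (d.F * d.ε) * d.ω = 0 →
      0 < d.LlogS
        + K * d.ω ^ 2 * (d.F * (1 + d.F * d.ε ^ 2) + d.ε * d.W ^ 2 * (d.f₁ * d.u₁ + d.f₂ * d.u₂))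
        + 8 * (d.Lη / d.η - (d.F * d.ε ^ 2 * d.η₁ ^ 2 + d.η₂ ^ 2) / d.η ^ 2
          - 4 * d.f * d.W * d.ε * d.ω * (d.u₁ * d.η₁ + d.u₂ * d.η₂) / d.η) := by
  obtain ⟨C₁, p₁, H₁⟩ := LlogS_lower Λ hm
  obtain ⟨C₂, p₂, H₂⟩ := UnifBdd.exists_pos
    (X := fun d => d.W ^ 2 * (d.f₁ * d.u₁ + d.f₂ * d.u₂)) (by fun_prop) Λ
  obtain ⟨C₃, p₃, H₃⟩ := UnifBdd.exists_pos
    (X := fun d => -2 * d.r ^ 2 * d.F * d.ε * d.ω ^ 2 + 2 * d.q * d.LE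
      + 2 * d.F * d.ε * (d.E₁ - d.x₂ * d.ω) ^ 2 + 2 * d.ε * d.E₂ ^ 2 - 4 * d.x₁ * d.ω * d.E₂)
    (by fun_prop) Λ
  obtain ⟨C₄, p₄, H₄⟩ := UnifBdd.exists_pos
    (X := fun d => 2 * d.q * d.E₂ - 2 * d.ε * d.E * d.x₁ * d.ω) (by fun_prop) Λ
  obtain ⟨C₅, p₅, H₅⟩ := UnifBdd.exists_pos
    (X := fun d => d.E * (d.ε ^ 2 * d.E - 2 * d.x₁ * d.x₂)) (by fun_prop) Λ
  obtain ⟨C₆, p₆, H₆⟩ := UnifBdd.exists_pos (X := fun d => d.F * d.η₁ ^ 2) (by fun_prop) Λ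
  obtain ⟨C₇, p₇, H₇⟩ := UnifBdd.exists_pos
    (X := fun d => 4 * d.f * d.W * d.ω * (d.u₁ * d.η₁ + d.u₂ * d.η₂)) (by fun_prop) Λ
  -- The gradient term contributes at least `K ω² m/2`. This pays for the `ω²` loss `C₁` of
  -- `LlogS_lower` and the loss `64/r²` of `cutoff_concavity`, and leaves one `ω²` over.
  set K : ℝ := 2 * (C₁ + 64 / r ^ 2 + 1) / m with hK
  have hK0 : 0 < K := by positivity
  obtain ⟨C₈, p₈, H₈⟩ := UnifBdd.exists_pos
    (X := fun d => d.F * d.ε * d.ρ * d.b - d.ρ * d.ε * d.s - K * d.u₂ * d.F * d.ω)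
    (by fun_prop) Λ
  -- This is the coercivity that remains on the unit sphere in `(ω, α, b)`; every error must add up
  -- to less than it.
  set c : ℝ := min (1 / 2) (m / 2) with hc
  have hc0 : 0 < c := by positivity
  -- All three left-hand sides are polynomials in `δ` that vanish at 0.
  obtain ⟨δ, hδ0, hδ1, hδ2, hδ3⟩ : ∃ δ : ℝ, 0 < δ ∧ δ * r ^ 4 * C₂ < m / 2 ∧
      δ ^ 2 * r ^ 4 * C₅ < 1 / 2 ∧
      C₁ * (δ * r ^ 4) + 8 * (δ * C₃ + δ ^ 2 * C₆ + δ * C₇) + 16 * (δ * C₄) ^ 2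
        + 3 / 2 * (δ * r ^ 4 * C₈) ^ 2 < c := by
    have t₁ : Filter.Tendsto (fun δ : ℝ => δ * r ^ 4 * C₂) (nhdsWithin 0 (Set.Ioi 0)) (nhds 0) :=
      tendsto_nhdsWithin_of_tendsto_nhds (Continuous.tendsto' (by fun_prop) _ _ (by simp))
    have t₂ : Filter.Tendsto (fun δ : ℝ => δ ^ 2 * r ^ 4 * C₅) (nhdsWithin 0 (Set.Ioi 0))
        (nhds 0) :=
      tendsto_nhdsWithin_of_tendsto_nhds (Continuous.tendsto' (by fun_prop) _ _ (by simp))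
    have t₃ : Filter.Tendsto (fun δ : ℝ => C₁ * (δ * r ^ 4)
        + 8 * (δ * C₃ + δ ^ 2 * C₆ + δ * C₇) + 16 * (δ * C₄) ^ 2
        + 3 / 2 * (δ * r ^ 4 * C₈) ^ 2) (nhdsWithin 0 (Set.Ioi 0)) (nhds 0) :=
      tendsto_nhdsWithin_of_tendsto_nhds (Continuous.tendsto' (by fun_prop) _ _ (by simp))
    obtain ⟨δ, ⟨⟨h₁, h₂⟩, h₃⟩, h₄⟩ := (((t₁.eventually (gt_mem_nhds (half_pos hm))).and
      (t₂.eventually (gt_mem_nhds (by norm_num : (0 : ℝ) < 1 / 2)))).and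
      (t₃.eventually (gt_mem_nhds hc0))).and self_mem_nhdsWithin |>.exists
    exact ⟨δ, h₄, h₁, h₂, h₃⟩
  refine ⟨K, hK0, δ, hδ0, fun d hd hdr hF hε hρ hsum hx hη hηr hεη hcrit => ?_⟩
  have hFpos : 0 < d.F := hm.trans_le hF
  have hεr : d.ε ≤ δ * r ^ 4 := hεη.trans (by gcongr)
  set θ : ℝ := d.ε / d.η with hθ
  have hθ0 : 0 < θ := by positivity
  have hθη : θ * d.η = d.ε := by rw [hθ]; field_simp
  have hθδ : θ ≤ δ := by rw [hθ, div_le_iff₀ hη]; exact hεη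
  set y₁ : ℝ := r ^ 2 - d.x₁ ^ 2 with hy₁
  set y₂ : ℝ := r ^ 2 - d.x₂ ^ 2 with hy₂
  -- the factorisation of the cutoff
  have hfac : d.η = y₁ * y₂ + d.ε ^ 2 * (d.E * (d.ε ^ 2 * d.E - 2 * d.x₁ * d.x₂)) := by
    simp only [η, q, hy₁, hy₂, hdr]; ring
  -- One factor `ε` is bounded by `δ r⁴` and the other by `δ η`, so the deviation from the product
  -- is small relative to `η` itself, even near the boundary.
  have herr : |d.ε ^ 2 * (d.E * (d.ε ^ 2 * d.E - 2 * d.x₁ * d.x₂))| ≤ d.η / 2 := by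
    rw [abs_mul, abs_of_pos (by positivity : 0 < d.ε ^ 2)]
    calc d.ε ^ 2 * |d.E * (d.ε ^ 2 * d.E - 2 * d.x₁ * d.x₂)|
        ≤ d.ε * d.ε * C₅ := by
          rw [← sq]; exact mul_le_mul_of_nonneg_left (H₅ d hd) (by positivity)
      _ ≤ (δ * r ^ 4) * (δ * d.η) * C₅ := by gcongr
      _ = (δ ^ 2 * r ^ 4 * C₅) * d.η := by ring
      _ ≤ 1 / 2 * d.η := by gcongr
      _ = d.η / 2 := by ring
  obtain ⟨herr₁, herr₂⟩ := abs_le.1 herr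
  have hyy₁ : d.η / 2 ≤ y₁ * y₂ := by linarith
  have hyy₂ : y₁ * y₂ ≤ 2 * d.η := by linarith
  -- A positive product with nonnegative sum makes both factors positive.
  have hyadd : 0 ≤ y₁ + y₂ := by rw [hy₁, hy₂]; linarith
  have hy₁0 : 0 < y₁ := by
    by_contra hcon
    have : y₁ * y₂ ≤ 0 := mul_nonpos_of_nonpos_of_nonneg (by linarith) (by linarith)
    linarith
  have hy₂0 : 0 < y₂ := by
    by_contra hcon
    have : y₁ * y₂ ≤ 0 := mul_nonpos_of_nonneg_of_nonpos (by linarith) (by linarith)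
    linarith
  have hconc := cutoff_concavity hr hη hy₁0 hy₂ hyy₁ hyy₂
  set Y : ℝ := y₁ / d.η with hY
  set Z : ℝ := d.η₂ / d.η with hZ
  set k := 2 * d.q * d.E₂ - 2 * d.ε * d.E * d.x₁ * d.ω with hk
  set l := -2 * d.r ^ 2 * d.F * d.ε * d.ω ^ 2 + 2 * d.q * d.LE
      + 2 * d.F * d.ε * (d.E₁ - d.x₂ * d.ω) ^ 2 + 2 * d.ε * d.E₂ ^ 2
      - 4 * d.x₁ * d.ω * d.E₂ with hl
  set j := d.F * d.ε * d.ρ * d.b - d.ρ * d.ε * d.s - K * d.u₂ * d.F * d.ω with hj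
  set e := 4 * d.f * d.W * d.ω * (d.u₁ * d.η₁ + d.u₂ * d.η₂) with he
  have hZeq : Z = -2 * d.ω * d.x₂ * Y + θ * k := by
    have : d.η₂ = -2 * d.ω * d.x₂ * y₁ + d.ε * k := by
      simp only [η₂, hk, q, hy₁, hdr]; ring
    rw [hZ, hY, hθ, this]; ring
  have hLeq : d.Lη / d.η = -2 * d.ω ^ 2 * Y + θ * l := by
    have : d.Lη = -2 * d.ω ^ 2 * y₁ + d.ε * l := by
      simp only [Lη, hl, hy₁, hdr]; ring
    rw [hY, hθ, this]; ring
  have hsq : (d.F * d.ε ^ 2 * d.η₁ ^ 2 + d.η₂ ^ 2) / d.η ^ 2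
      = θ ^ 2 * (d.F * d.η₁ ^ 2) + Z ^ 2 := by
    rw [hθ, hZ]; ring
  have htr : 4 * d.f * d.W * d.ε * d.ω * (d.u₁ * d.η₁ + d.u₂ * d.η₂) / d.η = θ * e := by
    rw [hθ, he]; ring
  -- Criticality in the second direction ties the normalised `u₁₁₂` to the logarithmic derivative of
  -- the cutoff.
  have hb : d.b = -8 * Z + d.ε * j := by
    rw [hj]; linear_combination hcrit - d.b * hρ
  -- estimates
  have b₁ := H₁ d hd hF hε hρ
  have b₂ : -(C₂ * d.ε) ≤ d.ε * d.W ^ 2 * (d.f₁ * d.u₁ + d.f₂ * d.u₂) := by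
    have := mul_le_mul_of_nonneg_left (abs_le.1 (H₂ d hd)).1 hε.le
    linarith
  have b₂' : m / 2 ≤ d.F * (1 + d.F * d.ε ^ 2)
      + d.ε * d.W ^ 2 * (d.f₁ * d.u₁ + d.f₂ * d.u₂) := by
    have i₁ : C₂ * d.ε ≤ m / 2 := by
      have : C₂ * d.ε ≤ C₂ * (δ * r ^ 4) := by gcongr
      linarith
    have i₂ : 0 ≤ d.F * (d.F * d.ε ^ 2) := by positivity
    linarith
  have b₂'' : (C₁ + 64 / r ^ 2 + 1) * d.ω ^ 2 ≤ K * d.ω ^ 2 * (d.F * (1 + d.F * d.ε ^ 2)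
      + d.ε * d.W ^ 2 * (d.f₁ * d.u₁ + d.f₂ * d.u₂)) := by
    have := mul_le_mul_of_nonneg_left b₂' (by positivity : 0 ≤ K * d.ω ^ 2)
    refine le_trans (le_of_eq ?_) this
    rw [hK]; field_simp
  have b₃ : -(δ * C₃) ≤ θ * l := by
    have := (abs_le.1 (H₃ d hd)).1
    have i₁ := mul_le_mul_of_nonneg_left this hθ0.le
    have i₂ : θ * C₃ ≤ δ * C₃ := by gcongr
    linarith
  have b₇ : θ * e ≤ δ * C₇ := by
    have i₁ := mul_le_mul_of_nonneg_left (abs_le.1 (H₇ d hd)).2 hθ0.le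
    have i₂ : θ * C₇ ≤ δ * C₇ := by gcongr
    exact i₁.trans i₂
  have b₆ : θ ^ 2 * (d.F * d.η₁ ^ 2) ≤ δ ^ 2 * C₆ := by
    have i₁ := mul_le_mul_of_nonneg_left (abs_le.1 (H₆ d hd)).2 (sq_nonneg θ)
    have i₂ : θ ^ 2 * C₆ ≤ δ ^ 2 * C₆ := by gcongr
    exact i₁.trans i₂
  have b₄ : (θ * k) ^ 2 ≤ (δ * C₄) ^ 2 := by
    rw [← sq_abs, abs_mul, abs_of_pos hθ0]
    have := H₄ d hd
    gcongr
  have b₈ : (d.ε * j) ^ 2 ≤ (δ * r ^ 4 * C₈) ^ 2 := by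
    rw [← sq_abs, abs_mul, abs_of_pos hε]
    have := H₈ d hd
    gcongr
  have b₉ : C₁ * d.ε ≤ C₁ * (δ * r ^ 4) := by gcongr
  -- Half of `b²` is kept for coercivity. The other half gives `24 Z²`, of which `8 Z²` cancels the
  -- bad term of `8 log η`; the remaining `16 Z²` feeds the concavity estimate.
  have hbsq : 48 * Z ^ 2 - 3 * (d.ε * j) ^ 2 ≤ d.b ^ 2 := by
    rw [hb]; exact three_quarters_sq_le Z (d.ε * j)
  have hZsq : 2 * d.ω ^ 2 * d.x₂ ^ 2 * Y ^ 2 - (θ * k) ^ 2 ≤ Z ^ 2 := by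
    rw [hZeq]
    have := half_sq_sub_sq_le (-2 * d.ω * d.x₂ * Y) (θ * k)
    linarith
  have hconc' := mul_le_mul_of_nonneg_left hconc (sq_nonneg d.ω)
  have hcsum : c ≤ 1 / 2 * d.b ^ 2 + m / 2 * d.α ^ 2 + d.ω ^ 2 := by
    have i₁ : c * d.b ^ 2 ≤ 1 / 2 * d.b ^ 2 := by gcongr; exact min_le_left _ _
    have i₂ : c * d.α ^ 2 ≤ m / 2 * d.α ^ 2 := by gcongr; exact min_le_right _ _
    have i₃ : c * d.ω ^ 2 ≤ 1 * d.ω ^ 2 := by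
      gcongr; exact (min_le_left _ _).trans (by norm_num)
    have : c = c * (d.ω ^ 2 + d.α ^ 2 + d.b ^ 2) := by rw [hsum, mul_one]
    linarith
  rw [hLeq, hsq, htr]
  linarith

end PointData

/-! ### Jets at a maximum and their normalisation -/

/-- The jet of a solution at an interior maximum of the test function
`log Δu + 8 log η + K/2 (1 + |∇u|²)`, in a frame that diagonalises the Hessian. The cutoff is
`η = r⁴ - r²|x|² + (e - x₁x₂)²`. -/
structure CritJet (r K : ℝ) where
  (x₁ x₂ u₁ u₂ A D u₁₁₁ u₁₁₂ u₁₂₂ u₂₂₂ u₁₁₁₁ u₁₁₁₂ u₁₁₂₂ u₁₂₂₂ u₂₂₂₂ : ℝ)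
  (f f₁ f₂ f₁₁ f₁₂ f₂₂ e e₁ e₂ e₁₁ e₂₂ : ℝ)
  A_pos : 0 < A
  D_pos : 0 < D
  eqn : A * D = f * (1 + u₁ ^ 2 + u₂ ^ 2) ^ 2
  eqn₁ : D * u₁₁₁ + A * u₁₂₂
    = f₁ * (1 + u₁ ^ 2 + u₂ ^ 2) ^ 2 + 4 * f * (1 + u₁ ^ 2 + u₂ ^ 2) * u₁ * A
  eqn₂ : D * u₁₁₂ + A * u₂₂₂
    = f₂ * (1 + u₁ ^ 2 + u₂ ^ 2) ^ 2 + 4 * f * (1 + u₁ ^ 2 + u₂ ^ 2) * u₂ * D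
  eqn₁₁ : D * u₁₁₁₁ + A * u₁₁₂₂ + 2 * u₁₁₁ * u₁₂₂ - 2 * u₁₁₂ ^ 2
    = f₁₁ * (1 + u₁ ^ 2 + u₂ ^ 2) ^ 2 + 8 * f₁ * (1 + u₁ ^ 2 + u₂ ^ 2) * u₁ * A
      + 8 * f * u₁ ^ 2 * A ^ 2
      + 4 * f * (1 + u₁ ^ 2 + u₂ ^ 2) * (A ^ 2 + u₁ * u₁₁₁ + u₂ * u₁₁₂)
  eqn₂₂ : D * u₁₁₂₂ + A * u₂₂₂₂ + 2 * u₁₁₂ * u₂₂₂ - 2 * u₁₂₂ ^ 2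
    = f₂₂ * (1 + u₁ ^ 2 + u₂ ^ 2) ^ 2 + 8 * f₂ * (1 + u₁ ^ 2 + u₂ ^ 2) * u₂ * D
      + 8 * f * u₂ ^ 2 * D ^ 2
      + 4 * f * (1 + u₁ ^ 2 + u₂ ^ 2) * (D ^ 2 + u₁ * u₁₂₂ + u₂ * u₂₂₂)
  eqn₁₂ : D * u₁₁₁₂ + A * u₁₂₂₂ + u₁₁₁ * u₂₂₂ - u₁₁₂ * u₁₂₂
    = f₁₂ * (1 + u₁ ^ 2 + u₂ ^ 2) ^ 2 + 4 * (1 + u₁ ^ 2 + u₂ ^ 2) * (f₁ * u₂ * D + f₂ * u₁ * A)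
      + 8 * f * u₁ * u₂ * A * D + 4 * f * (1 + u₁ ^ 2 + u₂ ^ 2) * (u₁ * u₁₁₂ + u₂ * u₁₂₂)
  eqn_e : e * (A + D) = 2 * x₁ * x₂ * D
  eqn_e₁ : e₁ * (A + D) + e * (u₁₁₁ + u₁₂₂)
    = (x₁ ^ 2 - x₂ ^ 2) * u₁₁₂ + 2 * x₁ * x₂ * u₁₂₂ + 2 * x₂ * D
  eqn_e₂ : e₂ * (A + D) + e * (u₁₁₂ + u₂₂₂)
    = (x₁ ^ 2 - x₂ ^ 2) * u₁₂₂ + 2 * x₁ * x₂ * u₂₂₂ + 2 * x₁ * D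
  eqn_e₁₁ : e₁₁ * (A + D) + 2 * e₁ * (u₁₁₁ + u₁₂₂) + e * (u₁₁₁₁ + u₁₁₂₂)
    = (x₁ ^ 2 - x₂ ^ 2) * u₁₁₁₂ + 2 * x₁ * x₂ * u₁₁₂₂ + 4 * x₁ * u₁₁₂ + 4 * x₂ * u₁₂₂
  eqn_e₂₂ : e₂₂ * (A + D) + 2 * e₂ * (u₁₁₂ + u₂₂₂) + e * (u₁₁₂₂ + u₂₂₂₂)
    = (x₁ ^ 2 - x₂ ^ 2) * u₁₂₂₂ + 2 * x₁ * x₂ * u₂₂₂₂ - 4 * x₂ * u₁₂₂ + 4 * x₁ * u₂₂₂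
  crit₁ : (u₁₁₁ + u₁₂₂) / (A + D)
      + 8 * ((-2 * r ^ 2 * x₁ + 2 * (e - x₁ * x₂) * (e₁ - x₂))
        / (r ^ 4 - r ^ 2 * (x₁ ^ 2 + x₂ ^ 2) + (e - x₁ * x₂) ^ 2))
      + K * (u₁ * A) = 0
  crit₂ : (u₁₁₂ + u₂₂₂) / (A + D)
      + 8 * ((-2 * r ^ 2 * x₂ + 2 * (e - x₁ * x₂) * (e₂ - x₁))
        / (r ^ 4 - r ^ 2 * (x₁ ^ 2 + x₂ ^ 2) + (e - x₁ * x₂) ^ 2))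
      + K * (u₂ * D) = 0
  max₁ : (u₁₁₁₁ + u₁₁₂₂) / (A + D) - ((u₁₁₁ + u₁₂₂) / (A + D)) ^ 2
      + 8 * ((-2 * r ^ 2 + 2 * (e₁ - x₂) ^ 2 + 2 * (e - x₁ * x₂) * e₁₁)
          / (r ^ 4 - r ^ 2 * (x₁ ^ 2 + x₂ ^ 2) + (e - x₁ * x₂) ^ 2)
        - ((-2 * r ^ 2 * x₁ + 2 * (e - x₁ * x₂) * (e₁ - x₂))
          / (r ^ 4 - r ^ 2 * (x₁ ^ 2 + x₂ ^ 2) + (e - x₁ * x₂) ^ 2)) ^ 2)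
      + K * (A ^ 2 + u₁ * u₁₁₁ + u₂ * u₁₁₂) ≤ 0
  max₂ : (u₁₁₂₂ + u₂₂₂₂) / (A + D) - ((u₁₁₂ + u₂₂₂) / (A + D)) ^ 2
      + 8 * ((-2 * r ^ 2 + 2 * (e₂ - x₁) ^ 2 + 2 * (e - x₁ * x₂) * e₂₂)
          / (r ^ 4 - r ^ 2 * (x₁ ^ 2 + x₂ ^ 2) + (e - x₁ * x₂) ^ 2)
        - ((-2 * r ^ 2 * x₂ + 2 * (e - x₁ * x₂) * (e₂ - x₁))
          / (r ^ 4 - r ^ 2 * (x₁ ^ 2 + x₂ ^ 2) + (e - x₁ * x₂) ^ 2)) ^ 2)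
      + K * (D ^ 2 + u₁ * u₁₂₂ + u₂ * u₂₂₂) ≤ 0

namespace CritJet

variable {r K : ℝ}

/-- The value of the cutoff. -/
def η (J : CritJet r K) : ℝ :=
  r ^ 4 - r ^ 2 * (J.x₁ ^ 2 + J.x₂ ^ 2) + (J.e - J.x₁ * J.x₂) ^ 2

/-- `w² = 1 + (u₁₁₁/A²)² + (u₁₁₂/A)²` normalises the third derivatives. -/
noncomputable def w (J : CritJet r K) : ℝ :=
  Real.sqrt (1 + (J.u₁₁₁ / J.A ^ 2) ^ 2 + (J.u₁₁₂ / J.A) ^ 2)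

lemma w_pos (J : CritJet r K) : 0 < J.w := Real.sqrt_pos.2 (by positivity)

/-- The normalised data of a jet. -/
noncomputable def data (J : CritJet r K) : PointData where
  x₁ := J.x₁
  x₂ := J.x₂
  u₁ := J.u₁
  u₂ := J.u₂
  f := J.f
  f₁ := J.f₁
  f₂ := J.f₂
  f₁₁ := J.f₁₁
  f₁₂ := J.f₁₂
  f₂₂ := J.f₂₂
  r := r
  ε := J.A⁻¹
  ρ := J.A / (J.A + J.D)
  ω := J.w⁻¹
  α := J.u₁₁₁ / J.A ^ 2 / J.w
  b := J.u₁₁₂ / J.A / J.w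

section identities

variable (J : CritJet r K)

lemma A_mul_ε : J.A * J.data.ε = 1 := mul_inv_cancel₀ J.A_pos.ne'

lemma w_mul_ω : J.w * J.data.ω = 1 := mul_inv_cancel₀ J.w_pos.ne'

lemma D_eq : J.D = J.data.F * J.data.ε := by
  have h := J.eqn
  have hA := J.A_pos.ne'
  simp only [PointData.F, PointData.W, data]
  field_simp
  linarith

lemma trace_mul : (J.A + J.D) * (J.data.ρ * J.data.ε) = 1 := by
  have hA := J.A_pos
  have hD := J.D_pos
  simp only [data]
  field_simp

lemma u₁₁₁_eq : J.u₁₁₁ = J.w * J.A ^ 2 * J.data.α := by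
  have hA := J.A_pos.ne'
  have hw := J.w_pos.ne'
  simp only [data]
  field_simp

lemma u₁₁₂_eq : J.u₁₁₂ = J.w * J.A * J.data.b := by
  have hA := J.A_pos.ne'
  have hw := J.w_pos.ne'
  simp only [data]
  field_simp

lemma ρ_mul : J.data.ρ * (1 + J.data.F * J.data.ε ^ 2) = 1 := by
  linear_combination J.trace_mul - J.data.ρ * J.A_mul_ε - J.data.ρ * J.data.ε * J.D_eq

lemma sum_sq : J.data.ω ^ 2 + J.data.α ^ 2 + J.data.b ^ 2 = 1 := by
  have hw := J.w_pos.ne'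
  have h : J.w ^ 2 = 1 + (J.u₁₁₁ / J.A ^ 2) ^ 2 + (J.u₁₁₂ / J.A) ^ 2 :=
    Real.sq_sqrt (by positivity)
  simp only [data]
  rw [inv_pow, div_pow _ J.w, div_pow _ J.w, ← one_div, ← add_div, ← add_div, ← h]
  field_simp

lemma W_eq : 1 + J.u₁ ^ 2 + J.u₂ ^ 2 = J.data.W := rfl

/-- The once differentiated equation expresses `u₁₂₂` through `u₁₁₁` and gains the factor `D/A`, of
order `ε²`. Thus `u₁₁₁` and `u₁₁₂` are the only free third derivatives. -/
lemma u₁₂₂_eq : J.u₁₂₂ = J.w * J.data.t := by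
  have h := J.eqn₁
  rw [W_eq, J.u₁₁₁_eq, J.D_eq] at h
  have hA := J.A_mul_ε
  have hw := J.w_mul_ω
  have e₁ : J.data.f₁ = J.f₁ := rfl
  have e₂ : J.data.f = J.f := rfl
  have e₃ : J.data.u₁ = J.u₁ := rfl
  simp only [PointData.t, PointData.φ₁, e₁, e₂, e₃]
  generalize J.data = d at *
  grind

lemma u₂₂₂_eq : J.u₂₂₂ = J.data.ε * J.w * J.data.s := by
  have h := J.eqn₂
  rw [W_eq, J.u₁₁₂_eq, J.D_eq] at h
  have hA := J.A_mul_ε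
  have hw := J.w_mul_ω
  have e₁ : J.data.f₂ = J.f₂ := rfl
  have e₂ : J.data.f = J.f := rfl
  have e₃ : J.data.u₂ = J.u₂ := rfl
  simp only [PointData.s, PointData.φ₂, e₁, e₂, e₃]
  generalize J.data = d at *
  grind

lemma e_eq : J.e = J.data.ε ^ 2 * J.data.E := by
  have h := J.eqn_e
  have hS := J.trace_mul
  have hD := J.D_eq
  have e₁ : J.data.x₁ = J.x₁ := rfl
  have e₂ : J.data.x₂ = J.x₂ := rfl
  simp only [PointData.E, e₁, e₂]
  linear_combination J.data.ρ * J.data.ε * h - J.e * hS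
    + 2 * J.x₁ * J.x₂ * J.data.ρ * J.data.ε * hD

lemma trace₁ : J.u₁₁₁ + J.u₁₂₂ = J.w * J.A ^ 2 * (J.data.α + J.data.ε ^ 2 * J.data.t) := by
  rw [J.u₁₁₁_eq, J.u₁₂₂_eq]
  linear_combination -J.w * J.data.t * (1 + J.A * J.data.ε) * J.A_mul_ε

lemma trace₂ : J.u₁₁₂ + J.u₂₂₂ = J.w * J.A * (J.data.b + J.data.ε ^ 2 * J.data.s) := by
  rw [J.u₁₁₂_eq, J.u₂₂₂_eq]
  linear_combination -J.w * J.data.s * J.data.ε * J.A_mul_ε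

lemma e₁_eq : J.e₁ = J.w * J.data.E₁ := by
  have h := J.eqn_e₁
  rw [J.trace₁, J.e_eq, J.u₁₁₂_eq, J.u₁₂₂_eq] at h
  have hS := J.trace_mul
  have hD := J.D_eq
  have hA := J.A_mul_ε
  have hw := J.w_mul_ω
  have e₁ : J.data.x₁ = J.x₁ := rfl
  have e₂ : J.data.x₂ = J.x₂ := rfl
  simp only [PointData.E₁, e₁, e₂]
  generalize J.data = d at *
  rw [hD] at h hS
  have h2 : J.e₁ = (d.ρ * d.ε) * (J.e₁ * (J.A + d.F * d.ε)) := by linear_combination -J.e₁ * hS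
  rw [h2, eq_sub_of_add_eq h]
  linear_combination (d.ρ * (J.x₁ ^ 2 - J.x₂ ^ 2) * J.w * d.b
      - d.ρ * J.w * d.E * d.ε * (d.α + d.ε ^ 2 * d.t) * (1 + J.A * d.ε)) * hA
    - 2 * d.ρ * J.x₂ * d.F * d.ε ^ 2 * hw

lemma e₂_eq : J.e₂ = J.data.ε * J.w * J.data.E₂ := by
  have h := J.eqn_e₂
  rw [J.trace₂, J.e_eq, J.u₁₂₂_eq, J.u₂₂₂_eq] at h
  have hS := J.trace_mul
  have hD := J.D_eq
  have hA := J.A_mul_ε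
  have hw := J.w_mul_ω
  have e₁ : J.data.x₁ = J.x₁ := rfl
  have e₂ : J.data.x₂ = J.x₂ := rfl
  simp only [PointData.E₂, e₁, e₂]
  generalize J.data = d at *
  rw [hD] at h hS
  have h2 : J.e₂ = (d.ρ * d.ε) * (J.e₂ * (J.A + d.F * d.ε)) := by linear_combination -J.e₂ * hS
  rw [h2, eq_sub_of_add_eq h]
  linear_combination
      - d.ρ * J.w * d.E * d.ε ^ 2 * (d.b + d.ε ^ 2 * d.s) * hA
    - 2 * d.ρ * J.x₁ * d.F * d.ε ^ 2 * hw

/-- The linearised operator on `u₂₂`. -/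
lemma lin_u₂₂ : J.D * J.u₁₁₂₂ + J.A * J.u₂₂₂₂
    = J.w ^ 2 * (J.data.F₂₂ + 2 * (J.data.t ^ 2 - J.data.b * J.data.s)) := by
  have h := J.eqn₂₂
  rw [W_eq] at h
  have h' := eq_sub_of_add_eq (eq_add_of_sub_eq h)
  rw [h', J.u₁₁₂_eq, J.u₁₂₂_eq, J.u₂₂₂_eq, J.D_eq]
  have hA := J.A_mul_ε
  have hw := J.w_mul_ω
  simp only [PointData.F₂₂]
  have e₁ : J.data.u₁ = J.u₁ := rfl
  have e₂ : J.data.u₂ = J.u₂ := rfl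
  have e₃ : J.data.f = J.f := rfl
  have e₄ : J.data.f₂ = J.f₂ := rfl
  have e₅ : J.data.f₂₂ = J.f₂₂ := rfl
  simp only [e₁, e₂, e₃, e₄, e₅]
  generalize J.data = d at *
  linear_combination - 2 * J.w ^ 2 * d.b * d.s * hA
    - ((J.w * d.ω + 1) * (J.f₂₂ * d.W ^ 2 + 8 * J.f₂ * d.W * J.u₂ * (d.F * d.ε)
      + 8 * J.f * J.u₂ ^ 2 * (d.F * d.ε) ^ 2 + 4 * J.f * d.W * (d.F * d.ε) ^ 2)
      + 4 * J.f * d.W * J.w * (J.u₁ * d.t + J.u₂ * d.ε * d.s)) * hw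

/-- The linearised operator on `u₁₂`. -/
lemma lin_u₁₂ : J.D * J.u₁₁₁₂ + J.A * J.u₁₂₂₂
    = J.w ^ 2 * J.A * (J.data.F₁₂ + J.data.b * J.data.t - J.data.α * J.data.s) := by
  have h := J.eqn₁₂
  rw [W_eq] at h
  have h' := eq_sub_of_add_eq (eq_add_of_sub_eq h)
  rw [h', J.u₁₁₁_eq, J.u₁₁₂_eq, J.u₁₂₂_eq, J.u₂₂₂_eq, J.D_eq]
  have hA := J.A_mul_ε
  have hw := J.w_mul_ω
  simp only [PointData.F₁₂]
  have e₁ : J.data.u₁ = J.u₁ := rfl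
  have e₂ : J.data.u₂ = J.u₂ := rfl
  have e₃ : J.data.f = J.f := rfl
  have e₄ : J.data.f₂ = J.f₂ := rfl
  have e₅ : J.data.f₁ = J.f₁ := rfl
  have e₆ : J.data.f₁₂ = J.f₁₂ := rfl
  simp only [e₁, e₂, e₃, e₄, e₅, e₆]
  generalize J.data = d at *
  have hA' : J.A = d.ε⁻¹ := eq_inv_of_mul_eq_one_left hA
  have hw' : J.w = d.ω⁻¹ := eq_inv_of_mul_eq_one_left hw
  have hε : d.ε ≠ 0 := right_ne_zero_of_mul_eq_one hA
  have hω : d.ω ≠ 0 := right_ne_zero_of_mul_eq_one hw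
  rw [hA', hw']
  field_simp

/-- The linearised operator on `Δu`. -/
lemma lin_trace : J.D * (J.u₁₁₁₁ + J.u₁₁₂₂) + J.A * (J.u₁₁₂₂ + J.u₂₂₂₂)
    = J.w ^ 2 * J.A ^ 2 * (J.data.F₁₁ + J.data.ε ^ 2 * J.data.F₂₂
        + 2 * (J.data.b ^ 2 - J.data.α * J.data.t
          + J.data.ε ^ 2 * (J.data.t ^ 2 - J.data.b * J.data.s))) := by
  have h := J.eqn₁₁
  rw [W_eq] at h
  have h' := eq_sub_of_add_eq (eq_add_of_sub_eq h)
  have h2 : J.D * (J.u₁₁₁₁ + J.u₁₁₂₂) + J.A * (J.u₁₁₂₂ + J.u₂₂₂₂)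
    = (J.D * J.u₁₁₁₁ + J.A * J.u₁₁₂₂) + (J.D * J.u₁₁₂₂ + J.A * J.u₂₂₂₂) := by ring
  rw [h2, J.lin_u₂₂, h', J.u₁₁₁_eq, J.u₁₁₂_eq, J.u₁₂₂_eq]
  have hA := J.A_mul_ε
  have hw := J.w_mul_ω
  simp only [PointData.F₁₁]
  have e₁ : J.data.u₁ = J.u₁ := rfl
  have e₂ : J.data.u₂ = J.u₂ := rfl
  have e₃ : J.data.f = J.f := rfl
  have e₅ : J.data.f₁ = J.f₁ := rfl
  have e₆ : J.data.f₁₁ = J.f₁₁ := rfl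
  simp only [e₁, e₂, e₃, e₅, e₆]
  generalize J.data = d at *
  have hA' : J.A = d.ε⁻¹ := eq_inv_of_mul_eq_one_left hA
  have hw' : J.w = d.ω⁻¹ := eq_inv_of_mul_eq_one_left hw
  have hε : d.ε ≠ 0 := right_ne_zero_of_mul_eq_one hA
  have hω : d.ω ≠ 0 := right_ne_zero_of_mul_eq_one hw
  rw [hA', hw']
  field_simp
  ring

/-- The linearised operator on the defect. -/
lemma lin_e : J.D * J.e₁₁ + J.A * J.e₂₂ = J.w ^ 2 * J.data.LE := by
  -- In this combination the fourth derivatives occur only through the linearised operator acting on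
  -- `u₁₂`, `u₂₂` and `Δu`.
  have h : (J.D * J.e₁₁ + J.A * J.e₂₂) * (J.A + J.D)
      = (J.x₁ ^ 2 - J.x₂ ^ 2) * (J.D * J.u₁₁₁₂ + J.A * J.u₁₂₂₂)
        + 2 * J.x₁ * J.x₂ * (J.D * J.u₁₁₂₂ + J.A * J.u₂₂₂₂)
        + J.D * (4 * J.x₁ * J.u₁₁₂ + 4 * J.x₂ * J.u₁₂₂)
        + J.A * (4 * J.x₁ * J.u₂₂₂ - 4 * J.x₂ * J.u₁₂₂)
        - 2 * (J.D * J.e₁ * (J.u₁₁₁ + J.u₁₂₂) + J.A * J.e₂ * (J.u₁₁₂ + J.u₂₂₂))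
        - J.e * (J.D * (J.u₁₁₁₁ + J.u₁₁₂₂) + J.A * (J.u₁₁₂₂ + J.u₂₂₂₂)) := by
    linear_combination J.D * J.eqn_e₁₁ + J.A * J.eqn_e₂₂
  rw [J.lin_trace, J.lin_u₁₂, J.lin_u₂₂, J.trace₁, J.trace₂, J.e₁_eq, J.e₂_eq, J.e_eq,
    J.u₁₁₂_eq, J.u₁₂₂_eq, J.u₂₂₂_eq] at h
  have h2 : J.D * J.e₁₁ + J.A * J.e₂₂
      = (J.data.ρ * J.data.ε) * ((J.D * J.e₁₁ + J.A * J.e₂₂) * (J.A + J.D)) := by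
    linear_combination -(J.D * J.e₁₁ + J.A * J.e₂₂) * J.trace_mul
  rw [h2, h, J.D_eq]
  have hA := J.A_mul_ε
  have hw := J.w_mul_ω
  simp only [PointData.LE]
  have e₁ : J.data.x₁ = J.x₁ := rfl
  have e₂ : J.data.x₂ = J.x₂ := rfl
  simp only [e₁, e₂]
  clear h h2
  generalize J.data = d at *
  have hA' : J.A = d.ε⁻¹ := eq_inv_of_mul_eq_one_left hA
  have hw' : J.w = d.ω⁻¹ := eq_inv_of_mul_eq_one_left hw
  have hε : d.ε ≠ 0 := right_ne_zero_of_mul_eq_one hA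
  have hω : d.ω ≠ 0 := right_ne_zero_of_mul_eq_one hw
  rw [hA', hw']
  field_simp

lemma η_eq : J.η = J.data.η := by
  simp only [η, PointData.η, PointData.q, ← J.e_eq]
  rfl

lemma η₁_eq : -2 * r ^ 2 * J.x₁ + 2 * (J.e - J.x₁ * J.x₂) * (J.e₁ - J.x₂)
    = J.w * J.data.η₁ := by
  have hw := J.w_mul_ω
  simp only [PointData.η₁, PointData.q, J.e_eq, J.e₁_eq]
  have e₁ : J.data.x₁ = J.x₁ := rfl
  have e₂ : J.data.x₂ = J.x₂ := rfl
  have e₃ : J.data.r = r := rfl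
  simp only [e₁, e₂, e₃]
  linear_combination (2 * r ^ 2 * J.x₁ + 2 * (J.data.ε ^ 2 * J.data.E - J.x₁ * J.x₂) * J.x₂) * hw

lemma η₂_eq : -2 * r ^ 2 * J.x₂ + 2 * (J.e - J.x₁ * J.x₂) * (J.e₂ - J.x₁)
    = J.w * J.data.η₂ := by
  have hw := J.w_mul_ω
  simp only [PointData.η₂, PointData.q, J.e_eq, J.e₂_eq]
  have e₁ : J.data.x₁ = J.x₁ := rfl
  have e₂ : J.data.x₂ = J.x₂ := rfl
  have e₃ : J.data.r = r := rfl
  simp only [e₁, e₂, e₃]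
  linear_combination (2 * r ^ 2 * J.x₂ + 2 * (J.data.ε ^ 2 * J.data.E - J.x₁ * J.x₂) * J.x₁) * hw

/-- The linearised operator on the cutoff. -/
lemma lin_η : J.D * (-2 * r ^ 2 + 2 * (J.e₁ - J.x₂) ^ 2 + 2 * (J.e - J.x₁ * J.x₂) * J.e₁₁)
      + J.A * (-2 * r ^ 2 + 2 * (J.e₂ - J.x₁) ^ 2 + 2 * (J.e - J.x₁ * J.x₂) * J.e₂₂)
    = J.A * J.w ^ 2 * J.data.Lη := by
  have h : J.D * (-2 * r ^ 2 + 2 * (J.e₁ - J.x₂) ^ 2 + 2 * (J.e - J.x₁ * J.x₂) * J.e₁₁)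
      + J.A * (-2 * r ^ 2 + 2 * (J.e₂ - J.x₁) ^ 2 + 2 * (J.e - J.x₁ * J.x₂) * J.e₂₂)
      = -2 * r ^ 2 * (J.A + J.D) + 2 * J.D * (J.e₁ - J.x₂) ^ 2 + 2 * J.A * (J.e₂ - J.x₁) ^ 2
        + 2 * (J.e - J.x₁ * J.x₂) * (J.D * J.e₁₁ + J.A * J.e₂₂) := by ring
  rw [h, J.lin_e, J.e_eq, J.e₁_eq, J.e₂_eq, J.D_eq]
  have hA := J.A_mul_ε
  have hw := J.w_mul_ω
  simp only [PointData.Lη, PointData.q]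
  have e₁ : J.data.x₁ = J.x₁ := rfl
  have e₂ : J.data.x₂ = J.x₂ := rfl
  have e₃ : J.data.r = r := rfl
  simp only [e₁, e₂, e₃]
  clear h
  generalize J.data = d at *
  have hA' : J.A = d.ε⁻¹ := eq_inv_of_mul_eq_one_left hA
  have hw' : J.w = d.ω⁻¹ := eq_inv_of_mul_eq_one_left hw
  have hε : d.ε ≠ 0 := right_ne_zero_of_mul_eq_one hA
  have hω : d.ω ≠ 0 := right_ne_zero_of_mul_eq_one hw
  rw [hA', hw']
  field_simp
  ring

lemma trace_inv : (J.A + J.D)⁻¹ = J.data.ρ * J.data.ε :=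
  inv_eq_of_mul_eq_one_right J.trace_mul

/-- The corrected linearised operator on `log Δu`. -/
lemma lin_log_trace :
    J.D * ((J.u₁₁₁₁ + J.u₁₁₂₂) / (J.A + J.D) - ((J.u₁₁₁ + J.u₁₂₂) / (J.A + J.D)) ^ 2)
      + J.A * ((J.u₁₁₂₂ + J.u₂₂₂₂) / (J.A + J.D) - ((J.u₁₁₂ + J.u₂₂₂) / (J.A + J.D)) ^ 2)
      - 4 * J.f * J.data.W * (J.u₁ * ((J.u₁₁₁ + J.u₁₂₂) / (J.A + J.D))
        + J.u₂ * ((J.u₁₁₂ + J.u₂₂₂) / (J.A + J.D)))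
    = J.A * J.w ^ 2 * J.data.LlogS := by
  have h : J.D * ((J.u₁₁₁₁ + J.u₁₁₂₂) / (J.A + J.D) - ((J.u₁₁₁ + J.u₁₂₂) / (J.A + J.D)) ^ 2)
      + J.A * ((J.u₁₁₂₂ + J.u₂₂₂₂) / (J.A + J.D) - ((J.u₁₁₂ + J.u₂₂₂) / (J.A + J.D)) ^ 2)
      = (J.D * (J.u₁₁₁₁ + J.u₁₁₂₂) + J.A * (J.u₁₁₂₂ + J.u₂₂₂₂)) * (J.A + J.D)⁻¹
        - (J.D * (J.u₁₁₁ + J.u₁₂₂) ^ 2 + J.A * (J.u₁₁₂ + J.u₂₂₂) ^ 2) * ((J.A + J.D)⁻¹) ^ 2 := by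
    ring
  rw [h, J.lin_trace, div_eq_mul_inv, div_eq_mul_inv, J.trace_inv, J.trace₁, J.trace₂, J.D_eq]
  have hA := J.A_mul_ε
  have hw := J.w_mul_ω
  simp only [PointData.LlogS, PointData.F₁₁, PointData.F₂₂, PointData.g]
  have e₁ : J.data.u₁ = J.u₁ := rfl
  have e₂ : J.data.u₂ = J.u₂ := rfl
  have e₃ : J.data.f = J.f := rfl
  have ht : J.data.F * J.data.α = J.data.φ₁ * J.data.ω - J.data.t := by
    simp only [PointData.t]; ring
  simp only [e₁, e₂, e₃]
  clear h
  generalize J.data = d at *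
  have hA' : J.A = d.ε⁻¹ := eq_inv_of_mul_eq_one_left hA
  have hw' : J.w = d.ω⁻¹ := eq_inv_of_mul_eq_one_left hw
  have hε : d.ε ≠ 0 := right_ne_zero_of_mul_eq_one hA
  have hω : d.ω ≠ 0 := right_ne_zero_of_mul_eq_one hw
  rw [hA', hw']
  field_simp
  linear_combination -2 * d.ρ * d.α * ht

/-- The corrected linearised operator on `(1 + |∇u|²) / 2`. -/
lemma lin_grad :
    J.D * (J.A ^ 2 + J.u₁ * J.u₁₁₁ + J.u₂ * J.u₁₁₂) + J.A * (J.D ^ 2 + J.u₁ * J.u₁₂₂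
        + J.u₂ * J.u₂₂₂) - 4 * J.f * J.data.W * (J.u₁ * (J.u₁ * J.A) + J.u₂ * (J.u₂ * J.D))
    = J.A * J.w ^ 2 * (J.data.ω ^ 2 * (J.data.F * (1 + J.data.F * J.data.ε ^ 2)
        + J.data.ε * J.data.W ^ 2 * (J.f₁ * J.u₁ + J.f₂ * J.u₂))) := by
  have h₁ := J.eqn₁
  have h₂ := J.eqn₂
  rw [W_eq] at h₁ h₂
  -- The transport term cancels exactly the gradient part of the differentiated right-hand side, so
  -- no third derivatives remain.
  have h : J.D * (J.A ^ 2 + J.u₁ * J.u₁₁₁ + J.u₂ * J.u₁₁₂) + J.A * (J.D ^ 2 + J.u₁ * J.u₁₂₂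
        + J.u₂ * J.u₂₂₂) - 4 * J.f * J.data.W * (J.u₁ * (J.u₁ * J.A) + J.u₂ * (J.u₂ * J.D))
      = J.A * J.D * (J.A + J.D) + J.data.W ^ 2 * (J.f₁ * J.u₁ + J.f₂ * J.u₂) := by
    linear_combination J.u₁ * h₁ + J.u₂ * h₂
  rw [h, J.D_eq]
  have hA := J.A_mul_ε
  have hw := J.w_mul_ω
  clear h h₁ h₂
  generalize J.data = d at *
  have hA' : J.A = d.ε⁻¹ := eq_inv_of_mul_eq_one_left hA
  have hw' : J.w = d.ω⁻¹ := eq_inv_of_mul_eq_one_left hw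
  have hε : d.ε ≠ 0 := right_ne_zero_of_mul_eq_one hA
  have hω : d.ω ≠ 0 := right_ne_zero_of_mul_eq_one hw
  rw [hA', hw']
  field_simp

/-- The twist equals `-x₁x₂(A - D)/(A + D)`, so its square is at most `x₁²x₂² ≤ |x|⁴/4`, which
`r²|x|²` dominates when `|x|² ≤ 2r²`. -/
lemma η_le (hx : J.x₁ ^ 2 + J.x₂ ^ 2 ≤ 2 * r ^ 2) : J.η ≤ r ^ 4 := by
  have hA := J.A_pos
  have hD := J.D_pos
  have h : (J.e - J.x₁ * J.x₂) * (J.A + J.D) = -(J.x₁ * J.x₂) * (J.A - J.D) := by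
    linear_combination J.eqn_e
  have hq : (J.e - J.x₁ * J.x₂) ^ 2 ≤ (J.x₁ * J.x₂) ^ 2 := by
    have h2 : (J.e - J.x₁ * J.x₂) ^ 2 * (J.A + J.D) ^ 2
        ≤ (J.x₁ * J.x₂) ^ 2 * (J.A + J.D) ^ 2 := by
      rw [← mul_pow, h, mul_pow, neg_sq]
      refine mul_le_mul_of_nonneg_left ?_ (sq_nonneg _)
      nlinarith [mul_pos hA hD]
    exact le_of_mul_le_mul_right h2 (by positivity)
  have h3 : (J.x₁ * J.x₂) ^ 2 ≤ r ^ 2 * (J.x₁ ^ 2 + J.x₂ ^ 2) := by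
    nlinarith [sq_nonneg (J.x₁ ^ 2 - J.x₂ ^ 2), mul_nonneg (add_nonneg (sq_nonneg J.x₁)
      (sq_nonneg J.x₂)) (sub_nonneg.2 hx), sq_nonneg (J.x₁ ^ 2 + J.x₂ ^ 2)]
  simp only [η]
  linarith

/-- The maximum conditions, combined and normalised. -/
lemma normalised_max :
    J.data.LlogS
        + K * J.data.ω ^ 2 * (J.data.F * (1 + J.data.F * J.data.ε ^ 2)
          + J.data.ε * J.data.W ^ 2 * (J.data.f₁ * J.data.u₁ + J.data.f₂ * J.data.u₂))
        + 8 * (J.data.Lη / J.data.η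
          - (J.data.F * J.data.ε ^ 2 * J.data.η₁ ^ 2 + J.data.η₂ ^ 2) / J.data.η ^ 2
          - 4 * J.data.f * J.data.W * J.data.ε * J.data.ω
            * (J.data.u₁ * J.data.η₁ + J.data.u₂ * J.data.η₂) / J.data.η) ≤ 0 := by
  have hA := J.A_mul_ε
  have hw := J.w_mul_ω
  have m₁ := mul_nonpos_of_nonneg_of_nonpos J.D_pos.le J.max₁
  have m₂ := mul_nonpos_of_nonneg_of_nonpos J.A_pos.le J.max₂
  have c₁ := J.crit₁
  have c₂ := J.crit₂
  have l₁ := J.lin_log_trace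
  have l₂ := J.lin_grad
  have l₃ := J.lin_η
  have hη : r ^ 4 - r ^ 2 * (J.x₁ ^ 2 + J.x₂ ^ 2) + (J.e - J.x₁ * J.x₂) ^ 2 = J.data.η := J.η_eq
  rw [hη, J.η₁_eq] at m₁ c₁
  rw [hη, J.η₂_eq] at m₂ c₂
  have hpos : 0 < J.A * J.w ^ 2 := mul_pos J.A_pos (pow_pos J.w_pos 2)
  refine nonpos_of_mul_nonpos_right ?_ hpos
  have key : J.A * J.w ^ 2 * (J.data.LlogS
        + K * J.data.ω ^ 2 * (J.data.F * (1 + J.data.F * J.data.ε ^ 2)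
          + J.data.ε * J.data.W ^ 2 * (J.data.f₁ * J.data.u₁ + J.data.f₂ * J.data.u₂))
        + 8 * (J.data.Lη / J.data.η
          - (J.data.F * J.data.ε ^ 2 * J.data.η₁ ^ 2 + J.data.η₂ ^ 2) / J.data.η ^ 2
          - 4 * J.data.f * J.data.W * J.data.ε * J.data.ω
            * (J.data.u₁ * J.data.η₁ + J.data.u₂ * J.data.η₂) / J.data.η))
      = J.A * J.w ^ 2 * J.data.LlogS
        + K * (J.A * J.w ^ 2 * (J.data.ω ^ 2 * (J.data.F * (1 + J.data.F * J.data.ε ^ 2)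
        + J.data.ε * J.data.W ^ 2 * (J.f₁ * J.u₁ + J.f₂ * J.u₂))))
        + 8 * (J.A * J.w ^ 2 * J.data.Lη / J.data.η
          - (J.D * (J.w * J.data.η₁ / J.data.η) ^ 2 + J.A * (J.w * J.data.η₂ / J.data.η) ^ 2)
          - 4 * J.f * J.data.W
            * (J.u₁ * (J.w * J.data.η₁ / J.data.η) + J.u₂ * (J.w * J.data.η₂ / J.data.η))) := by
    rw [J.D_eq]
    have e₁ : J.data.u₁ = J.u₁ := rfl
    have e₂ : J.data.u₂ = J.u₂ := rfl
    have e₃ : J.data.f = J.f := rfl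
    have e₄ : J.data.f₁ = J.f₁ := rfl
    have e₅ : J.data.f₂ = J.f₂ := rfl
    simp only [e₁, e₂, e₃, e₄, e₅, div_eq_mul_inv, inv_pow, mul_pow]
    clear l₁ l₂ l₃ m₁ m₂ c₁ c₂ hη hpos
    generalize J.data = d at *
    linear_combination (-8 * J.w ^ 2 * d.F * d.ε * d.η₁ ^ 2 * (d.η ^ 2)⁻¹
        - 32 * J.w ^ 2 * J.f * d.W * d.ω * (J.u₁ * d.η₁ + J.u₂ * d.η₂) * d.η⁻¹) * hA
      - 32 * J.w * J.f * d.W * (J.u₁ * d.η₁ + J.u₂ * d.η₂) * d.η⁻¹ * hw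
  rw [key, ← l₁, ← l₂, ← l₃]
  -- The first-order conditions let the transport term be added for free to `D` times the first
  -- maximum condition plus `A` times the second.
  have c₁' := congrArg (fun z => 4 * J.f * J.data.W * J.u₁ * z) c₁
  have c₂' := congrArg (fun z => 4 * J.f * J.data.W * J.u₂ * z) c₂
  simp only [mul_zero] at c₁' c₂'
  refine le_of_eq_of_le ?_ (add_nonpos m₁ m₂)
  linear_combination -c₁' - c₂'

lemma normalised_crit₂ :
    J.data.ρ * (J.data.b + J.data.ε ^ 2 * J.data.s) + 8 * (J.data.η₂ / J.data.η)
      + K * J.data.u₂ * (J.data.F * J.data.ε) * J.data.ω = 0 := by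
  have c := J.crit₂
  have hη : r ^ 4 - r ^ 2 * (J.x₁ ^ 2 + J.x₂ ^ 2) + (J.e - J.x₁ * J.x₂) ^ 2 = J.data.η := J.η_eq
  rw [hη, J.η₂_eq, J.trace₂, div_eq_mul_inv _ (J.A + J.D), J.trace_inv, J.D_eq] at c
  have hA := J.A_mul_ε
  have hw := J.w_mul_ω
  have e₂ : J.data.u₂ = J.u₂ := rfl
  rw [e₂]
  clear hη
  generalize J.data = d at *
  linear_combination d.ω * c - d.ρ * (d.b + d.ε ^ 2 * d.s) * (J.w * d.ω * hA + hw)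
    - 8 * (d.η₂ / d.η) * hw

end identities

/-- All lower order quantities of the jet are bounded by `Λ`. -/
structure Bounds (Λ m : ℝ) (J : CritJet r K) : Prop where
  x₁ : |J.x₁| ≤ Λ
  x₂ : |J.x₂| ≤ Λ
  u₁ : |J.u₁| ≤ Λ
  u₂ : |J.u₂| ≤ Λ
  f : |J.f| ≤ Λ
  f₁ : |J.f₁| ≤ Λ
  f₂ : |J.f₂| ≤ Λ
  f₁₁ : |J.f₁₁| ≤ Λ
  f₁₂ : |J.f₁₂| ≤ Λ
  f₂₂ : |J.f₂₂| ≤ Λ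
  le_f : m ≤ J.f

/-- At an interior maximum of the test function, the product of the large eigenvalue and the
cutoff is bounded. -/
theorem exists_bound (Λ m r : ℝ) (hm : 0 < m) (hr : 0 < r) :
    ∃ K, 0 < K ∧ ∃ T, 0 < T ∧ ∀ J : CritJet r K, J.Bounds Λ m →
      J.x₁ ^ 2 + J.x₂ ^ 2 ≤ 2 * r ^ 2 → 0 < J.η → J.A * J.η ≤ T := by
  -- The box must also contain `r` and the quantities `ε, ρ, ω, α, b`, which are at most 1 in
  -- absolute value.
  set Λ' := max Λ (max r 1) with hΛ'
  have hΛ : Λ ≤ Λ' := le_max_left _ _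
  have hrΛ : r ≤ Λ' := (le_max_left _ _).trans (le_max_right _ _)
  have h1Λ : 1 ≤ Λ' := (le_max_right _ _).trans (le_max_right _ _)
  obtain ⟨K, hK, δ, hδ, H⟩ := PointData.exists_threshold Λ' m r hm hr
  -- Exceeding `δ⁻¹` means `ε < δ η`; exceeding `r⁴ ≥ η` forces `A ≥ 1`, hence `ε ≤ 1`.
  refine ⟨K, hK, max δ⁻¹ (r ^ 4), by positivity, fun J hJ hx hη => ?_⟩
  by_contra hcon
  rw [not_le, max_lt_iff] at hcon
  obtain ⟨hc₁, hc₂⟩ := hcon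
  have hA := J.A_pos
  have hD := J.D_pos
  have hw := J.w_pos
  have hηr := J.η_le hx
  have hA1 : 1 ≤ J.A := by
    by_contra h
    have : J.A * J.η ≤ 1 * J.η := mul_le_mul_of_nonneg_right (not_le.1 h).le hη.le
    linarith
  have hsum := J.sum_sq
  have hunit : ∀ x : ℝ, x ^ 2 ≤ 1 → |x| ≤ Λ' := fun x hx =>
    ((sq_le_one_iff_abs_le_one x).1 hx).trans h1Λ
  have hbox : J.data.InBox Λ' :=
    { x₁ := hJ.x₁.trans hΛ
      x₂ := hJ.x₂.trans hΛ
      u₁ := hJ.u₁.trans hΛ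
      u₂ := hJ.u₂.trans hΛ
      f := hJ.f.trans hΛ
      f₁ := hJ.f₁.trans hΛ
      f₂ := hJ.f₂.trans hΛ
      f₁₁ := hJ.f₁₁.trans hΛ
      f₁₂ := hJ.f₁₂.trans hΛ
      f₂₂ := hJ.f₂₂.trans hΛ
      r := by
        change |r| ≤ Λ'
        rwa [abs_of_pos hr]
      ε := by
        change |J.A⁻¹| ≤ Λ'
        rw [abs_of_pos (by positivity)]
        exact (inv_le_one_of_one_le₀ hA1).trans h1Λ
      ρ := by
        change |J.A / (J.A + J.D)| ≤ Λ'
        rw [abs_of_pos (by positivity)]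
        exact ((div_le_one (by positivity)).2 (by linarith)).trans h1Λ
      ω := hunit _ (by nlinarith [sq_nonneg J.data.α, sq_nonneg J.data.b])
      α := hunit _ (by nlinarith [sq_nonneg J.data.ω, sq_nonneg J.data.b])
      b := hunit _ (by nlinarith [sq_nonneg J.data.α, sq_nonneg J.data.ω]) }
  have hF : m ≤ J.data.F := by
    change m ≤ J.f * (1 + J.u₁ ^ 2 + J.u₂ ^ 2) ^ 2
    have h1 : (1 : ℝ) ≤ (1 + J.u₁ ^ 2 + J.u₂ ^ 2) ^ 2 :=
      one_le_pow₀ (by nlinarith [sq_nonneg J.u₁, sq_nonneg J.u₂])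
    have h2 := hJ.le_f
    calc m ≤ J.f := h2
      _ = J.f * 1 := (mul_one _).symm
      _ ≤ _ := mul_le_mul_of_nonneg_left h1 (hm.le.trans h2)
  have hε : J.data.ε ≤ δ * J.data.η := by
    rw [← J.η_eq]
    change J.A⁻¹ ≤ δ * J.η
    rw [inv_le_iff_one_le_mul₀ hA]
    have := mul_lt_mul_of_pos_left hc₁ hδ
    rw [mul_inv_cancel₀ hδ.ne'] at this
    linarith
  have hpos := H J.data hbox rfl hF (inv_pos.2 hA) J.ρ_mul hsum hx (J.η_eq ▸ hη) (J.η_eq ▸ hηr) hε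
    J.normalised_crit₂
  exact absurd J.normalised_max (not_le.2 hpos)

end CritJet

/-! ### Second-order jets of functions of one variable -/

open Filter Topology in
/-- `g` is twice differentiable at `0` with value `a` and derivatives `b` and `c`. -/
def HasJet (g : ℝ → ℝ) (a b c : ℝ) : Prop :=
  g 0 = a ∧ ∃ g' : ℝ → ℝ, (∀ᶠ t in 𝓝 0, HasDerivAt g (g' t) t) ∧ g' 0 = b ∧ HasDerivAt g' c 0

namespace HasJet

open Filter Topology

variable {g h : ℝ → ℝ} {a b c a' b' c' : ℝ}

lemma const (k : ℝ) : HasJet (fun _ => k) k 0 0 :=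
  ⟨rfl, fun _ => 0, .of_forall fun t => hasDerivAt_const t k, rfl, hasDerivAt_const _ _⟩

lemma affine (k l : ℝ) : HasJet (fun t => k + t * l) k l 0 :=
  ⟨by simp, fun _ => l, .of_forall fun t => by
    simpa using ((hasDerivAt_id t).mul_const l).const_add k, rfl, hasDerivAt_const _ _⟩

lemma hasDerivAt (hg : HasJet g a b c) : HasDerivAt g b 0 := by
  obtain ⟨-, g', h₁, rfl, -⟩ := hg
  exact h₁.self_of_nhds

lemma congr (hg : HasJet g a b c) (hgh : g =ᶠ[𝓝 0] h) : HasJet h a b c := by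
  obtain ⟨h₀, g', h₁, h₂, h₃⟩ := hg
  refine ⟨hgh.eq_of_nhds ▸ h₀, g', ?_, h₂, h₃⟩
  filter_upwards [h₁, eventually_eventually_nhds.2 hgh] with t ht ht'
  exact ht.congr_of_eventuallyEq (ht'.mono fun _ hy => hy.symm)

/-- This is the device for differentiating an identity twice: compute the jets of both sides and
compare. -/
lemma unique (hg : HasJet g a b c) (hg' : HasJet g a' b' c') : a = a' ∧ b = b' ∧ c = c' := by
  obtain ⟨h₀, g₁, h₁, h₂, h₃⟩ := hg
  obtain ⟨k₀, g₂, k₁, k₂, k₃⟩ := hg'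
  have he : g₁ =ᶠ[𝓝 0] g₂ := by
    filter_upwards [h₁, k₁] with t ht kt using ht.unique kt
  refine ⟨h₀ ▸ k₀, h₂ ▸ k₂ ▸ he.eq_of_nhds, ?_⟩
  exact h₃.unique (k₃.congr_of_eventuallyEq he)

lemma add (hg : HasJet g a b c) (hh : HasJet h a' b' c') :
    HasJet (fun t => g t + h t) (a + a') (b + b') (c + c') := by
  obtain ⟨rfl, g', h₁, rfl, h₃⟩ := hg
  obtain ⟨rfl, k', k₁, rfl, k₃⟩ := hh
  refine ⟨rfl, fun t => g' t + k' t, ?_, rfl, h₃.add k₃⟩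
  filter_upwards [h₁, k₁] with t ht kt using ht.add kt

lemma mul (hg : HasJet g a b c) (hh : HasJet h a' b' c') :
    HasJet (fun t => g t * h t) (a * a') (b * a' + a * b') (c * a' + 2 * b * b' + a * c') := by
  have hg₀ := hg.hasDerivAt
  have hh₀ := hh.hasDerivAt
  obtain ⟨rfl, g', h₁, rfl, h₃⟩ := hg
  obtain ⟨rfl, k', k₁, rfl, k₃⟩ := hh
  refine ⟨rfl, fun t => g' t * h t + g t * k' t, ?_, rfl, ?_⟩
  · filter_upwards [h₁, k₁] with t ht kt using ht.mul kt
  · exact ((h₃.mul hh₀).add (hg₀.mul k₃)).congr_deriv (by ring)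

lemma const_mul (k : ℝ) (hg : HasJet g a b c) :
    HasJet (fun t => k * g t) (k * a) (k * b) (k * c) := by
  obtain ⟨rfl, g', h₁, rfl, h₃⟩ := hg
  refine ⟨rfl, fun t => k * g' t, ?_, rfl, h₃.const_mul k⟩
  filter_upwards [h₁] with t ht using ht.const_mul k

lemma sub (hg : HasJet g a b c) (hh : HasJet h a' b' c') :
    HasJet (fun t => g t - h t) (a - a') (b - b') (c - c') := by
  obtain ⟨rfl, g', h₁, rfl, h₃⟩ := hg
  obtain ⟨rfl, k', k₁, rfl, k₃⟩ := hh
  refine ⟨rfl, fun t => g' t - k' t, ?_, rfl, h₃.sub k₃⟩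
  filter_upwards [h₁, k₁] with t ht kt using ht.sub kt

lemma sq (hg : HasJet g a b c) :
    HasJet (fun t => g t ^ 2) (a ^ 2) (2 * a * b) (2 * (b ^ 2 + a * c)) := by
  have := hg.mul hg
  simp only [← _root_.sq] at this
  convert this using 1 <;> ring

/-- The derivatives stay unnamed. For the twist they are recovered by multiplying the quotient by
its denominator, which gives relations free of division by powers of the trace. -/
lemma exists_inv (hg : HasJet g a b c) (ha : a ≠ 0) :
    ∃ b' c', HasJet (fun t => (g t)⁻¹) a⁻¹ b' c' := by
  have hg₀ := hg.hasDerivAt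
  obtain ⟨rfl, g', h₁, rfl, h₃⟩ := hg
  refine ⟨_, _, rfl, fun t => -g' t / g t ^ 2, ?_, rfl,
    h₃.neg.div (hg₀.pow 2) (pow_ne_zero 2 ha)⟩
  filter_upwards [h₁, hg₀.continuousAt.eventually_ne ha] with t ht hne using ht.inv hne

lemma exists_div (hg : HasJet g a b c) (hh : HasJet h a' b' c') (ha : a' ≠ 0) :
    ∃ p q, HasJet (fun t => g t / h t) (a / a') p q := by
  obtain ⟨p, q, hpq⟩ := hh.exists_inv ha
  exact ⟨_, _, by simpa only [div_eq_mul_inv] using hg.mul hpq⟩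

lemma log (hg : HasJet g a b c) (ha : a ≠ 0) :
    HasJet (fun t => Real.log (g t)) (Real.log a) (b / a) (c / a - (b / a) ^ 2) := by
  have hg₀ := hg.hasDerivAt
  obtain ⟨rfl, g', h₁, rfl, h₃⟩ := hg
  refine ⟨rfl, fun t => g' t / g t, ?_, rfl, ?_⟩
  · filter_upwards [h₁, hg₀.continuousAt.eventually_ne ha] with t ht hne using ht.log hne
  · exact (h₃.div hg₀ ha).congr_deriv (by field_simp)

/-- First and second order conditions at a local maximum. -/
lemma of_isLocalMax (hg : HasJet g a b c) (hmax : IsLocalMax g 0) : b = 0 ∧ c ≤ 0 := by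
  have hb : b = 0 := hmax.hasDerivAt_eq_zero hg.hasDerivAt
  refine ⟨hb, ?_⟩
  by_contra! hc
  obtain ⟨-, g', h₁, h₂, h₃⟩ := id hg
  have hd : deriv g =ᶠ[𝓝 0] g' := h₁.mono fun t ht => ht.deriv
  have hdd : deriv (deriv g) 0 = c := hd.deriv_eq.trans h₃.deriv
  -- A positive second derivative would make the point a strict minimum candidate as well; being
  -- both maximum and minimum, `g` is locally constant, which contradicts `c > 0`.
  have hmin : IsLocalMin g 0 := isLocalMin_of_deriv_deriv_pos (by rw [hdd]; exact hc)
    (by rw [hg.hasDerivAt.deriv, hb]) hg.hasDerivAt.continuousAt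
  have heq : g =ᶠ[𝓝 0] fun _ => g 0 := by
    filter_upwards [hmax, hmin] with t h₁ h₂ using le_antisymm h₁ h₂
  exact hc.ne' (hg.unique ((HasJet.const (g 0)).congr heq.symm)).2.2

end HasJet

/-! ### Directional derivatives and jets along lines -/

section directional

open Filter Topology

variable {V : Type*} [NormedAddCommGroup V] [NormedSpace ℝ V] {s : Set V} {u g h : V → ℝ} {x : V}

/-- The directional derivative. -/
noncomputable def pd (v : V) (g : V → ℝ) (x : V) : ℝ := fderiv ℝ g x v

lemma pd_congr (hs : IsOpen s) (hgh : Set.EqOn g h s) (v : V) : Set.EqOn (pd v g) (pd v h) s :=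
  fun x hx => by
    simp only [pd]
    rw [(hgh.eventuallyEq_of_mem (hs.mem_nhds hx)).fderiv_eq]

lemma ContDiffOn.pd {n m : WithTop ℕ∞} (hg : ContDiffOn ℝ n g s) (hs : IsOpen s) (hmn : m + 1 ≤ n)
    (v : V) : ContDiffOn ℝ m (pd v g) s :=
  (hg.fderiv_of_isOpen hs hmn).clm_apply contDiffOn_const

lemma pd_pd (hg : ContDiffOn ℝ 2 g s) (hs : IsOpen s) (hx : x ∈ s) (v w : V) :
    pd v (pd w g) x = fderiv ℝ (fderiv ℝ g) x v w := by
  have hd : DifferentiableAt ℝ (fderiv ℝ g) x :=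
    ((hg.fderiv_of_isOpen hs (m := 1) (by norm_num)).differentiableOn
      (by norm_num)).differentiableAt (hs.mem_nhds hx)
  have h := hd.hasFDerivAt.clm_apply (hasFDerivAt_const w x)
  change fderiv ℝ (fun y => fderiv ℝ g y w) x v = _
  rw [h.fderiv]
  simp

lemma snd_fderiv_symm (hg : ContDiffOn ℝ 2 g s) (hs : IsOpen s) (hx : x ∈ s) (v w : V) :
    fderiv ℝ (fderiv ℝ g) x v w = fderiv ℝ (fderiv ℝ g) x w v :=
  ((hg.contDiffAt (hs.mem_nhds hx)).isSymmSndFDerivAt (by simp)).eq v w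

lemma pd_comm (hg : ContDiffOn ℝ 2 g s) (hs : IsOpen s) (v w : V) :
    Set.EqOn (pd v (pd w g)) (pd w (pd v g)) s := fun x hx => by
  rw [pd_pd hg hs hx, pd_pd hg hs hx, snd_fderiv_symm hg hs hx]

lemma pd_add_dir (v w : V) : pd (v + w) g x = pd v g x + pd w g x := by
  simp [pd]

lemma pd_pd_add_dir (hg : ContDiffOn ℝ 2 g s) (hs : IsOpen s) (hx : x ∈ s) (v w : V) :
    pd (v + w) (pd (v + w) g) x
      = pd v (pd v g) x + 2 * pd v (pd w g) x + pd w (pd w g) x := by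
  simp only [pd_pd hg hs hx, map_add, add_apply]
  rw [snd_fderiv_symm hg hs hx w v]
  ring

lemma hasJet_line (hg : ContDiffOn ℝ 2 g s) (hs : IsOpen s) (hx : x ∈ s) (v : V) :
    HasJet (fun t : ℝ => g (x + t • v)) (g x) (pd v g x) (pd v (pd v g) x) := by
  have hline : ∀ t : ℝ, HasDerivAt (fun t : ℝ => x + t • v) v t := fun t => by
    simpa using ((hasDerivAt_id t).smul_const v).const_add x
  have key : ∀ k : V → ℝ, ContDiffOn ℝ 1 k s → ∀ t : ℝ, x + t • v ∈ s →
      HasDerivAt (fun t : ℝ => k (x + t • v)) (pd v k (x + t • v)) t := fun k hk t ht =>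
    (((hk.differentiableOn (by norm_num)).differentiableAt
      (hs.mem_nhds ht)).hasFDerivAt).comp_hasDerivAt t (hline t)
  refine ⟨by simp, fun t => pd v g (x + t • v), ?_, by simp, ?_⟩
  · have hc : ContinuousAt (fun t : ℝ => x + t • v) 0 := (hline 0).continuousAt
    have : ∀ᶠ t : ℝ in 𝓝 0, x + t • v ∈ s := hc (hs.mem_nhds (by simpa using hx))
    filter_upwards [this] with t ht
    exact key g (hg.of_le (by norm_num)) t ht
  · simpa using key (pd v g) (hg.pd hs (by norm_num) v) 0 (by simpa using hx)

lemma line_mem (hs : IsOpen s) (hx : x ∈ s) (v : V) : ∀ᶠ t : ℝ in 𝓝 0, x + t • v ∈ s := by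
  have hc : ContinuousAt (fun t : ℝ => x + t • v) 0 := by fun_prop
  exact hc (hs.mem_nhds (by simpa using hx))

/-- By midpoint convexity, `u(x + tv) + u(x - tv)` has a minimum at `t = 0`, and its second
derivative there is twice the one sought. -/
lemma ConvexOn.pd_pd_nonneg (hu : ConvexOn ℝ s u) (hg : ContDiffOn ℝ 2 u s) (hs : IsOpen s)
    (hx : x ∈ s) (v : V) : 0 ≤ pd v (pd v u) x := by
  have h₁ := hasJet_line hg hs hx v
  have h₂ := hasJet_line hg hs hx (-v)
  have h₃ : pd (-v) (pd (-v) u) x = pd v (pd v u) x := by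
    simp only [pd_pd hg hs hx, map_neg, neg_apply, neg_neg]
  have hj := (h₁.add h₂).const_mul (-1)
  have hmax : IsLocalMax (fun t : ℝ => -1 * (u (x + t • v) + u (x + t • -v))) 0 := by
    filter_upwards [line_mem hs hx v, line_mem hs hx (-v)] with t ht ht'
    have := hu.2 ht ht' (by norm_num : (0 : ℝ) ≤ 1 / 2) (by norm_num : (0 : ℝ) ≤ 1 / 2)
      (by norm_num)
    have he : (1 / 2 : ℝ) • (x + t • v) + (1 / 2 : ℝ) • (x + t • -v) = x := by
      module
    rw [he] at this
    simp only [smul_eq_mul] at this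
    simp only [zero_smul, add_zero]
    linarith
  have := (hj.of_isLocalMax hmax).2
  rw [h₃] at this
  linarith

end directional

/-! ### Jets of the equation, the twist and the cutoff -/

namespace HasJet

open Filter Topology

variable {a b d p q φ X Y : ℝ → ℝ} {a₀ a₁ a₂ b₁ b₂ d₀ d₁ d₂ p₀ p₁ p₂ q₀ q₁ q₂ f₀ f₁ f₂ : ℝ}
  {x y l k : ℝ}

/-- The 2-jet along a line of the prescribed Gauss curvature equation, at a point where the
Hessian is diagonal. -/
lemma gauss_equation (ha : HasJet a a₀ a₁ a₂) (hb : HasJet b 0 b₁ b₂) (hd : HasJet d d₀ d₁ d₂)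
    (hp : HasJet p p₀ p₁ p₂) (hq : HasJet q q₀ q₁ q₂) (hf : HasJet φ f₀ f₁ f₂)
    (h : ∀ᶠ t in 𝓝 0, a t * d t - b t ^ 2 = φ t * (1 + p t ^ 2 + q t ^ 2) ^ 2) :
    a₀ * d₀ = f₀ * (1 + p₀ ^ 2 + q₀ ^ 2) ^ 2 ∧
    d₀ * a₁ + a₀ * d₁ = f₁ * (1 + p₀ ^ 2 + q₀ ^ 2) ^ 2
      + 4 * f₀ * (1 + p₀ ^ 2 + q₀ ^ 2) * (p₀ * p₁ + q₀ * q₁) ∧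
    d₀ * a₂ + a₀ * d₂ + 2 * a₁ * d₁ - 2 * b₁ ^ 2 = f₂ * (1 + p₀ ^ 2 + q₀ ^ 2) ^ 2
      + 8 * f₁ * (1 + p₀ ^ 2 + q₀ ^ 2) * (p₀ * p₁ + q₀ * q₁)
      + 8 * f₀ * (p₀ * p₁ + q₀ * q₁) ^ 2
      + 4 * f₀ * (1 + p₀ ^ 2 + q₀ ^ 2) * (p₁ ^ 2 + q₁ ^ 2 + p₀ * p₂ + q₀ * q₂) := by
  have hl := ((ha.mul hd).sub hb.sq).congr h
  obtain ⟨h₀, h₁, h₂⟩ := hl.unique (hf.mul ((((const 1).add hp.sq).add hq.sq).sq))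
  refine ⟨?_, ?_, ?_⟩
  · linear_combination h₀
  · linear_combination h₁
  · linear_combination h₂

/-- The 2-jet along a line of the twist
`((x² - y²) u₁₂ - x y (u₁₁ - u₂₂)) / Δu`, at a point where the Hessian is diagonal. -/
lemma exists_twist (ha : HasJet a a₀ a₁ a₂) (hb : HasJet b 0 b₁ b₂) (hd : HasJet d d₀ d₁ d₂)
    (hX : HasJet X x l 0) (hY : HasJet Y y k 0) (had : a₀ + d₀ ≠ 0) :
    ∃ e₁ e₂, HasJet
        (fun t => ((X t ^ 2 - Y t ^ 2) * b t - X t * Y t * (a t - d t)) / (a t + d t))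
        (2 * x * y * d₀ / (a₀ + d₀) - x * y) (e₁ - (l * y + x * k)) (e₂ - 2 * l * k) ∧
      e₁ * (a₀ + d₀) + 2 * x * y * d₀ / (a₀ + d₀) * (a₁ + d₁)
        = (x ^ 2 - y ^ 2) * b₁ + 2 * x * y * d₁ + 2 * (l * y + x * k) * d₀ ∧
      e₂ * (a₀ + d₀) + 2 * e₁ * (a₁ + d₁) + 2 * x * y * d₀ / (a₀ + d₀) * (a₂ + d₂)
        = (x ^ 2 - y ^ 2) * b₂ + 2 * x * y * d₂ + 4 * (l * y + x * k) * d₁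
          + 4 * (x * l - y * k) * b₁ + 4 * l * k * d₀ := by
  have hQ := ((hX.sq.sub hY.sq).mul hb).sub ((hX.mul hY).mul (ha.sub hd))
  have hS := ha.add hd
  obtain ⟨q₁, q₂, hq⟩ := hQ.exists_div hS had
  have hprod := hq.mul hS
  have hne : ∀ᶠ t in 𝓝 0, a t + d t ≠ 0 := by
    have := hS.hasDerivAt.continuousAt.eventually_ne
      (show (fun t => a t + d t) 0 ≠ 0 by
        rw [show (fun t => a t + d t) 0 = a₀ + d₀ from hS.1]
        exact had)
    exact this
  have heq := hprod.congr (h := fun t => (X t ^ 2 - Y t ^ 2) * b t - X t * Y t * (a t - d t)) (by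
    filter_upwards [hne] with t ht using div_mul_cancel₀ _ ht)
  obtain ⟨-, h₁, h₂⟩ := heq.unique hQ
  have hq₀ : ((x ^ 2 - y ^ 2) * 0 - x * y * (a₀ - d₀)) / (a₀ + d₀)
      = 2 * x * y * d₀ / (a₀ + d₀) - x * y := by
    field_simp; ring
  rw [hq₀] at hq h₁ h₂
  refine ⟨q₁ + (l * y + x * k), q₂ + 2 * l * k, ?_, ?_, ?_⟩
  · simpa only [add_sub_cancel_right] using hq
  · linear_combination h₁
  · linear_combination h₂

lemma cutoff (r : ℝ) (hX : HasJet X x l 0) (hY : HasJet Y y k 0) (hq : HasJet q q₀ q₁ q₂) :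
    HasJet (fun t => r ^ 4 - r ^ 2 * (X t ^ 2 + Y t ^ 2) + q t ^ 2)
      (r ^ 4 - r ^ 2 * (x ^ 2 + y ^ 2) + q₀ ^ 2)
      (-2 * r ^ 2 * (x * l + y * k) + 2 * q₀ * q₁)
      (-2 * r ^ 2 * (l ^ 2 + k ^ 2) + 2 * q₁ ^ 2 + 2 * q₀ * q₂) := by
  convert ((const (r ^ 4)).sub ((hX.sq.add hY.sq).const_mul (r ^ 2))).add hq.sq using 1 <;> ring

end HasJet

/-! ### The test function in a frame and its critical jet -/

section frame

open Filter Topology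

variable {V : Type*} [NormedAddCommGroup V] [NormedSpace ℝ V]

/-- The Laplacian in the frame `e₁, e₂`. -/
noncomputable def lap (e₁ e₂ : V) (u : V → ℝ) (x : V) : ℝ :=
  pd e₁ (pd e₁ u) x + pd e₂ (pd e₂ u) x

/-- `1 + |∇u|²` in the frame `e₁, e₂`. -/
noncomputable def areaSq (e₁ e₂ : V) (u : V → ℝ) (x : V) : ℝ :=
  1 + pd e₁ u x ^ 2 + pd e₂ u x ^ 2

/-- `⟨∇²u x, x^⊥⟩ / Δu` in the frame `e₁, e₂` with dual frame `l₁, l₂`. -/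
noncomputable def twist (e₁ e₂ : V) (l₁ l₂ : V →L[ℝ] ℝ) (u : V → ℝ) (x : V) : ℝ :=
  ((l₁ x ^ 2 - l₂ x ^ 2) * pd e₁ (pd e₂ u) x
    - l₁ x * l₂ x * (pd e₁ (pd e₁ u) x - pd e₂ (pd e₂ u) x)) / lap e₁ e₂ u x

/-- The cutoff `r⁴ - r²|x|² + twist²`. -/
noncomputable def cutoff (r : ℝ) (e₁ e₂ : V) (l₁ l₂ : V →L[ℝ] ℝ) (u : V → ℝ) (x : V) : ℝ :=
  r ^ 4 - r ^ 2 * (l₁ x ^ 2 + l₂ x ^ 2) + twist e₁ e₂ l₁ l₂ u x ^ 2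

/-- The test function of the maximum principle. -/
noncomputable def testFn (r K : ℝ) (e₁ e₂ : V) (l₁ l₂ : V →L[ℝ] ℝ) (u : V → ℝ) (x : V) : ℝ :=
  Real.log (lap e₁ e₂ u x) + 8 * Real.log (cutoff r e₁ e₂ l₁ l₂ u x)
    + K / 2 * areaSq e₁ e₂ u x

lemma hasJet_coord (l : V →L[ℝ] ℝ) (x v : V) :
    HasJet (fun t : ℝ => l (x + t • v)) (l x) (l v) 0 := by
  simpa using HasJet.affine (l x) (l v)

lemma IsLocalMax.line {g : V → ℝ} {x : V} (h : IsLocalMax g x) (v : V) :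
    IsLocalMax (fun t : ℝ => g (x + t • v)) 0 := by
  have hc : Tendsto (fun t : ℝ => x + t • v) (𝓝 0) (𝓝 x) :=
    Continuous.tendsto' (by fun_prop) _ _ (by simp)
  filter_upwards [hc.eventually h] with t ht
  simpa using ht

variable {s : Set V} {u f : V → ℝ} {x : V} {r K : ℝ} {e₁ e₂ : V} {l₁ l₂ : V →L[ℝ] ℝ}

/-- At an interior maximum of the test function, the derivatives of the solution form a
`CritJet`. -/
theorem exists_critJet (hs : IsOpen s) (hx : x ∈ s) (hu : ContDiffOn ℝ 4 u s)
    (hf : ContDiffOn ℝ 2 f s)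
    (heq : ∀ y ∈ s, pd e₁ (pd e₁ u) y * pd e₂ (pd e₂ u) y - pd e₁ (pd e₂ u) y ^ 2
      = f y * (1 + pd e₁ u y ^ 2 + pd e₂ u y ^ 2) ^ 2)
    (h11 : l₁ e₁ = 1) (h12 : l₁ e₂ = 0) (h21 : l₂ e₁ = 0) (h22 : l₂ e₂ = 1)
    (hB : pd e₁ (pd e₂ u) x = 0) (hA : 0 < pd e₁ (pd e₁ u) x) (hD : 0 < pd e₂ (pd e₂ u) x)
    (hη : 0 < cutoff r e₁ e₂ l₁ l₂ u x) (hmax : IsLocalMax (testFn r K e₁ e₂ l₁ l₂ u) x) :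
    ∃ J : CritJet r K, J.x₁ = l₁ x ∧ J.x₂ = l₂ x ∧ J.u₁ = pd e₁ u x ∧ J.u₂ = pd e₂ u x ∧
      J.A = pd e₁ (pd e₁ u) x ∧ J.f = f x ∧ J.f₁ = pd e₁ f x ∧ J.f₂ = pd e₂ f x ∧
      J.f₁₁ = pd e₁ (pd e₁ f) x ∧ J.f₁₂ = pd e₁ (pd e₂ f) x ∧ J.f₂₂ = pd e₂ (pd e₂ f) x ∧
      J.η = cutoff r e₁ e₂ l₁ l₂ u x := by
  have c1 : ∀ v, ContDiffOn ℝ 3 (pd v u) s := fun v => hu.pd hs (by norm_num) v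
  have c1' : ∀ v, ContDiffOn ℝ 2 (pd v u) s := fun v => (c1 v).of_le (by norm_num)
  have c2 : ∀ v w, ContDiffOn ℝ 2 (pd v (pd w u)) s := fun v w => (c1 w).pd hs (by norm_num) v
  have hu2 : ContDiffOn ℝ 2 u s := hu.of_le (by norm_num)
  -- symmetry of the higher derivatives
  have s21 : Set.EqOn (pd e₂ (pd e₁ u)) (pd e₁ (pd e₂ u)) s := pd_comm hu2 hs e₂ e₁
  have s112 : Set.EqOn (pd e₁ (pd e₁ (pd e₂ u))) (pd e₂ (pd e₁ (pd e₁ u))) s :=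
    (pd_congr hs s21.symm e₁).trans (pd_comm (c1' e₁) hs e₁ e₂)
  have s122 : Set.EqOn (pd e₂ (pd e₁ (pd e₂ u))) (pd e₁ (pd e₂ (pd e₂ u))) s :=
    pd_comm (c1' e₂) hs e₂ e₁
  have s1112 := pd_congr hs s112 e₁ hx
  have s1222 : pd e₂ (pd e₂ (pd e₁ (pd e₂ u))) x = pd e₁ (pd e₂ (pd e₂ (pd e₂ u))) x :=
    (pd_congr hs s122 e₂ hx).trans (pd_comm (c2 e₂ e₂) hs e₂ e₁ hx)
  have s1122' : pd e₁ (pd e₂ (pd e₁ (pd e₂ u))) x = pd e₂ (pd e₂ (pd e₁ (pd e₁ u))) x :=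
    (pd_comm (c2 e₁ e₂) hs e₁ e₂ hx).trans (pd_congr hs s112 e₂ hx)
  have s1122 : pd e₁ (pd e₁ (pd e₂ (pd e₂ u))) x = pd e₂ (pd e₂ (pd e₁ (pd e₁ u))) x :=
    (pd_congr hs s122.symm e₁ hx).trans s1122'
  have su12 : pd e₂ (pd e₂ (pd e₁ u)) x = pd e₁ (pd e₂ (pd e₂ u)) x :=
    (pd_congr hs s21 e₂ hx).trans (s122 hx)
  have su21 : pd e₁ (pd e₂ (pd e₁ u)) x = pd e₂ (pd e₁ (pd e₁ u)) x :=
    pd_comm (c1' e₁) hs e₁ e₂ hx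
  have hB' : pd e₂ (pd e₁ u) x = 0 := (s21 hx).trans hB
  -- jets in the first direction
  have A1 := hasJet_line (c2 e₁ e₁) hs hx e₁
  have B1 := hasJet_line (c2 e₁ e₂) hs hx e₁
  have D1 := hasJet_line (c2 e₂ e₂) hs hx e₁
  have p1 := hasJet_line (c1' e₁) hs hx e₁
  have q1 := hasJet_line (c1' e₂) hs hx e₁
  have f1 := hasJet_line hf hs hx e₁
  have X1 := hasJet_coord l₁ x e₁
  have Y1 := hasJet_coord l₂ x e₁
  rw [hB, s112 hx, s1112] at B1
  rw [s1122] at D1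
  rw [hB, s112 hx] at q1
  rw [h11] at X1
  rw [h21] at Y1
  -- jets in the second direction
  have A2 := hasJet_line (c2 e₁ e₁) hs hx e₂
  have B2 := hasJet_line (c2 e₁ e₂) hs hx e₂
  have D2 := hasJet_line (c2 e₂ e₂) hs hx e₂
  have p2 := hasJet_line (c1' e₁) hs hx e₂
  have q2 := hasJet_line (c1' e₂) hs hx e₂
  have f2 := hasJet_line hf hs hx e₂
  have X2 := hasJet_coord l₁ x e₂
  have Y2 := hasJet_coord l₂ x e₂
  rw [hB, s122 hx, s1222] at B2
  rw [hB', su12] at p2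
  rw [h12] at X2
  rw [h22] at Y2
  -- jets in the diagonal direction
  have A3 := hasJet_line (c2 e₁ e₁) hs hx (e₁ + e₂)
  have B3 := hasJet_line (c2 e₁ e₂) hs hx (e₁ + e₂)
  have D3 := hasJet_line (c2 e₂ e₂) hs hx (e₁ + e₂)
  have p3 := hasJet_line (c1' e₁) hs hx (e₁ + e₂)
  have q3 := hasJet_line (c1' e₂) hs hx (e₁ + e₂)
  have f3 := hasJet_line hf hs hx (e₁ + e₂)
  rw [pd_pd_add_dir (c2 e₁ e₁) hs hx, pd_add_dir] at A3
  rw [pd_pd_add_dir (c2 e₁ e₂) hs hx, pd_add_dir, hB, s112 hx, s122 hx, s1112, s1222, s1122'] at B3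
  rw [pd_pd_add_dir (c2 e₂ e₂) hs hx, pd_add_dir, s1122] at D3
  rw [pd_pd_add_dir (c1' e₁) hs hx, pd_add_dir, hB', su12, su21] at p3
  rw [pd_pd_add_dir (c1' e₂) hs hx, pd_add_dir, hB, s112 hx] at q3
  rw [pd_pd_add_dir hf hs hx, pd_add_dir] at f3
  have heq' : ∀ v, ∀ᶠ t : ℝ in 𝓝 0, pd e₁ (pd e₁ u) (x + t • v) * pd e₂ (pd e₂ u) (x + t • v)
      - pd e₁ (pd e₂ u) (x + t • v) ^ 2 = f (x + t • v)
        * (1 + pd e₁ u (x + t • v) ^ 2 + pd e₂ u (x + t • v) ^ 2) ^ 2 := fun v =>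
    (line_mem hs hx v).mono fun t ht => heq _ ht
  obtain ⟨g0, g1, g11⟩ := HasJet.gauss_equation A1 B1 D1 p1 q1 f1 (heq' e₁)
  obtain ⟨-, g2, g22⟩ := HasJet.gauss_equation A2 B2 D2 p2 q2 f2 (heq' e₂)
  obtain ⟨-, -, g12⟩ := HasJet.gauss_equation A3 B3 D3 p3 q3 f3 (heq' (e₁ + e₂))
  have hS : 0 < pd e₁ (pd e₁ u) x + pd e₂ (pd e₂ u) x := add_pos hA hD
  obtain ⟨ε₁, ε₁₁, t1, k1, k11⟩ := HasJet.exists_twist A1 B1 D1 X1 Y1 hS.ne'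
  obtain ⟨ε₂, ε₂₂, t2, k2, k22⟩ := HasJet.exists_twist A2 B2 D2 X2 Y2 hS.ne'
  have n1 := HasJet.cutoff r X1 Y1 t1
  have n2 := HasJet.cutoff r X2 Y2 t2
  set e₀ := 2 * l₁ x * l₂ x * pd e₂ (pd e₂ u) x / (pd e₁ (pd e₁ u) x + pd e₂ (pd e₂ u) x) with he₀
  have hηx : cutoff r e₁ e₂ l₁ l₂ u x
      = r ^ 4 - r ^ 2 * (l₁ x ^ 2 + l₂ x ^ 2) + (e₀ - l₁ x * l₂ x) ^ 2 := by
    rw [← n1.1]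
    simp [cutoff, twist, lap]
  rw [hηx] at hη
  obtain ⟨m1, m11⟩ := ((((A1.add D1).log hS.ne').add ((n1.log hη.ne').const_mul 8)).add
    ((((HasJet.const 1).add p1.sq).add q1.sq).const_mul (K / 2))).of_isLocalMax (hmax.line e₁)
  obtain ⟨m2, m22⟩ := ((((A2.add D2).log hS.ne').add ((n2.log hη.ne').const_mul 8)).add
    ((((HasJet.const 1).add p2.sq).add q2.sq).const_mul (K / 2))).of_isLocalMax (hmax.line e₂)
  let J : CritJet r K :=
    { x₁ := l₁ x, x₂ := l₂ x, u₁ := pd e₁ u x, u₂ := pd e₂ u x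
      A := pd e₁ (pd e₁ u) x, D := pd e₂ (pd e₂ u) x
      u₁₁₁ := pd e₁ (pd e₁ (pd e₁ u)) x
      u₁₁₂ := pd e₂ (pd e₁ (pd e₁ u)) x
      u₁₂₂ := pd e₁ (pd e₂ (pd e₂ u)) x
      u₂₂₂ := pd e₂ (pd e₂ (pd e₂ u)) x
      u₁₁₁₁ := pd e₁ (pd e₁ (pd e₁ (pd e₁ u))) x
      u₁₁₁₂ := pd e₁ (pd e₂ (pd e₁ (pd e₁ u))) x
      u₁₁₂₂ := pd e₂ (pd e₂ (pd e₁ (pd e₁ u))) x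
      u₁₂₂₂ := pd e₁ (pd e₂ (pd e₂ (pd e₂ u))) x
      u₂₂₂₂ := pd e₂ (pd e₂ (pd e₂ (pd e₂ u))) x
      f := f x, f₁ := pd e₁ f x, f₂ := pd e₂ f x
      f₁₁ := pd e₁ (pd e₁ f) x, f₁₂ := pd e₁ (pd e₂ f) x, f₂₂ := pd e₂ (pd e₂ f) x
      e := e₀, e₁ := ε₁, e₂ := ε₂, e₁₁ := ε₁₁, e₂₂ := ε₂₂
      A_pos := hA
      D_pos := hD
      eqn := g0
      eqn₁ := by linear_combination g1
      eqn₂ := by linear_combination g2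
      eqn₁₁ := by linear_combination g11
      eqn₂₂ := by linear_combination g22
      -- Polarisation: the mixed derivative of the equation comes from its second derivatives along
      -- `e₁`, `e₂` and `e₁ + e₂`.
      eqn₁₂ := by linear_combination (g12 - g11 - g22) / 2
      eqn_e := div_mul_cancel₀ _ hS.ne'
      eqn_e₁ := by linear_combination k1
      eqn_e₂ := by linear_combination k2
      eqn_e₁₁ := by linear_combination k11
      eqn_e₂₂ := by linear_combination k22
      crit₁ := by rw [← m1]; ring
      crit₂ := by rw [← m2]; ring
      max₁ := by refine le_of_eq_of_le ?_ m11; ring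
      max₂ := by refine le_of_eq_of_le ?_ m22; ring }
  exact ⟨J, rfl, rfl, rfl, rfl, rfl, rfl, rfl, rfl, rfl, rfl, rfl, hηx.symm⟩

end frame

/-! ### Diagonalisation and rotation invariance -/

lemma exists_diagonalising_rotation (P Q R : ℝ) : ∃ c s : ℝ, c ^ 2 + s ^ 2 = 1 ∧
    -(c * s) * P + (c ^ 2 - s ^ 2) * Q + c * s * R = 0 ∧
    s ^ 2 * P - 2 * c * s * Q + c ^ 2 * R ≤ c ^ 2 * P + 2 * c * s * Q + s ^ 2 * R := by
  set z : ℂ := ⟨P - R, 2 * Q⟩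
  -- Rotating the frame by `θ` rotates the trace-free part of a symmetric matrix by `2θ`, so half
  -- the argument diagonalises it and puts the larger eigenvalue first.
  set θ := z.arg / 2 with hθ
  have hre : ‖z‖ * Real.cos (2 * θ) = P - R := by
    rw [hθ, mul_div_cancel₀ _ (two_ne_zero), Complex.norm_mul_cos_arg]
  have him : ‖z‖ * Real.sin (2 * θ) = 2 * Q := by
    rw [hθ, mul_div_cancel₀ _ (two_ne_zero), Complex.norm_mul_sin_arg]
  rw [Real.cos_two_mul'] at hre
  rw [Real.sin_two_mul] at him
  have h1 := Real.cos_sq_add_sin_sq θ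
  set c := Real.cos θ
  set s := Real.sin θ
  refine ⟨c, s, h1, ?_, ?_⟩
  · linear_combination (c * s) * hre - (c ^ 2 - s ^ 2) / 2 * him
  · have h : c ^ 2 * P + 2 * c * s * Q + s ^ 2 * R - (s ^ 2 * P - 2 * c * s * Q + c ^ 2 * R)
        = ‖z‖ := by
      linear_combination -(c ^ 2 - s ^ 2) * hre - 2 * c * s * him
        + ‖z‖ * (c ^ 2 + s ^ 2 + 1) * h1
    linarith [norm_nonneg z]

section rotation

variable {V : Type*} [NormedAddCommGroup V] [NormedSpace ℝ V] {S : Set V} {u : V → ℝ} {x : V}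
  {c s : ℝ} (a b : V) (l k : V →L[ℝ] ℝ)

lemma pd_lin (g : V → ℝ) (x : V) (c s : ℝ) :
    pd (c • a + s • b) g x = c * pd a g x + s * pd b g x := by
  simp [pd]

lemma pd_pd_lin (hu : ContDiffOn ℝ 2 u S) (hS : IsOpen S) (hx : x ∈ S) (c s c' s' : ℝ) :
    pd (c • a + s • b) (pd (c' • a + s' • b) u) x
      = c * c' * pd a (pd a u) x + (c * s' + s * c') * pd a (pd b u) x
        + s * s' * pd b (pd b u) x := by
  simp only [pd_pd hu hS hx, map_add, map_smul, add_apply, smul_apply, smul_eq_mul]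
  rw [snd_fderiv_symm hu hS hx b a]
  ring

lemma areaSq_rotate (h : c ^ 2 + s ^ 2 = 1) :
    areaSq (c • a + s • b) (-s • a + c • b) u x = areaSq a b u x := by
  simp only [areaSq, pd_lin]
  linear_combination (pd a u x ^ 2 + pd b u x ^ 2) * h

lemma lap_rotate (hu : ContDiffOn ℝ 2 u S) (hS : IsOpen S) (hx : x ∈ S) (h : c ^ 2 + s ^ 2 = 1) :
    lap (c • a + s • b) (-s • a + c • b) u x = lap a b u x := by
  simp only [lap, pd_pd_lin a b hu hS hx]
  linear_combination (pd a (pd a u) x + pd b (pd b u) x) * h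

/-- With z = (x₁ + i x₂)² and h = (u₁₁ - u₂₂)/2 + i u₁₂, the numerator is Im(z̄h). Both z and h turn
by the same double angle, so it is invariant. -/
lemma twist_rotate (hu : ContDiffOn ℝ 2 u S) (hS : IsOpen S) (hx : x ∈ S)
    (h : c ^ 2 + s ^ 2 = 1) :
    twist (c • a + s • b) (-s • a + c • b) (c • l + s • k) (-s • l + c • k) u x
      = twist a b l k u x := by
  simp only [twist, lap_rotate a b hu hS hx h]
  congr 1
  simp only [pd_pd_lin a b hu hS hx, add_apply, smul_apply, smul_eq_mul]
  linear_combination ((l x ^ 2 - k x ^ 2) * pd a (pd b u) x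
    - l x * k x * (pd a (pd a u) x - pd b (pd b u) x)) * (c ^ 2 + s ^ 2 + 1) * h

lemma cutoff_rotate (r : ℝ) (hu : ContDiffOn ℝ 2 u S) (hS : IsOpen S) (hx : x ∈ S)
    (h : c ^ 2 + s ^ 2 = 1) :
    cutoff r (c • a + s • b) (-s • a + c • b) (c • l + s • k) (-s • l + c • k) u x
      = cutoff r a b l k u x := by
  simp only [cutoff, twist_rotate a b l k hu hS hx h, add_apply, smul_apply, smul_eq_mul]
  linear_combination -r ^ 2 * (l x ^ 2 + k x ^ 2) * h

lemma testFn_rotate (r K : ℝ) (hu : ContDiffOn ℝ 2 u S) (hS : IsOpen S) (hx : x ∈ S)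
    (h : c ^ 2 + s ^ 2 = 1) :
    testFn r K (c • a + s • b) (-s • a + c • b) (c • l + s • k) (-s • l + c • k) u x
      = testFn r K a b l k u x := by
  simp only [testFn, cutoff_rotate a b l k r hu hS hx h, lap_rotate a b hu hS hx h,
    areaSq_rotate a b h]

lemma det_rotate (hu : ContDiffOn ℝ 2 u S) (hS : IsOpen S) (hx : x ∈ S)
    (h : c ^ 2 + s ^ 2 = 1) :
    pd (c • a + s • b) (pd (c • a + s • b) u) x * pd (-s • a + c • b) (pd (-s • a + c • b) u) x
        - pd (c • a + s • b) (pd (-s • a + c • b) u) x ^ 2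
      = pd a (pd a u) x * pd b (pd b u) x - pd a (pd b u) x ^ 2 := by
  simp only [pd_pd_lin a b hu hS hx]
  linear_combination (pd a (pd a u) x * pd b (pd b u) x - pd a (pd b u) x ^ 2)
    * (c ^ 2 + s ^ 2 + 1) * h

end rotation

/-! ### Coordinates on the Euclidean plane -/

section plane

/-- The Euclidean plane. -/
abbrev Plane : Type := EuclideanSpace ℝ (Fin 2)

/-- The standard basis of the plane. -/
noncomputable abbrev stdVec (i : Fin 2) : Plane := EuclideanSpace.single i 1

/-- The coordinates of the plane. -/
noncomputable abbrev stdCoord (i : Fin 2) : Plane →L[ℝ] ℝ := EuclideanSpace.proj i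

lemma sum_sq_stdCoord (x : Plane) : stdCoord 0 x ^ 2 + stdCoord 1 x ^ 2 = ‖x‖ ^ 2 := by
  rw [EuclideanSpace.real_norm_sq_eq, Fin.sum_univ_two]
  rfl

lemma gradient_apply (g : Plane → ℝ) (x : Plane) (i : Fin 2) :
    gradient g x i = pd (stdVec i) g x := by
  have h : inner ℝ (gradient g x) (stdVec i) = pd (stdVec i) g x := by
    simp only [gradient, pd, InnerProductSpace.toDual_symm_apply]
  rw [← h, EuclideanSpace.inner_single_right]
  simp

lemma norm_gradient_sq (g : Plane → ℝ) (x : Plane) :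
    ‖gradient g x‖ ^ 2 = pd (stdVec 0) g x ^ 2 + pd (stdVec 1) g x ^ 2 := by
  rw [EuclideanSpace.real_norm_sq_eq, Fin.sum_univ_two, gradient_apply, gradient_apply]

variable {s : Set Plane} {g : Plane → ℝ} {x : Plane}

lemma hessian_apply (hg : ContDiffOn ℝ 2 g s) (hs : IsOpen s) (hx : x ∈ s) (i j : Fin 2) :
    hessian g x i j = pd (stdVec i) (pd (stdVec j) g) x := by
  rw [pd_pd hg hs hx]
  rfl

lemma abs_hessian_le (g : Plane → ℝ) (x : Plane) (i j : Fin 2) :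
    |hessian g x i j| ≤ hessianNorm g x := by
  refine Real.abs_le_sqrt ?_
  refine le_trans ?_ (Finset.single_le_sum (f := fun i => ∑ j, hessian g x i j ^ 2)
    (fun i _ => Finset.sum_nonneg fun j _ => sq_nonneg _) (Finset.mem_univ i))
  exact Finset.single_le_sum (f := fun j => hessian g x i j ^ 2) (fun j _ => sq_nonneg _)
    (Finset.mem_univ j)

lemma abs_lin_le {c s p q B : ℝ} (h : c ^ 2 + s ^ 2 = 1) (hp : |p| ≤ B) (hq : |q| ≤ B) :
    |c * p + s * q| ≤ 2 * B := by
  have hc : |c| ≤ 1 := (sq_le_one_iff_abs_le_one c).1 (by nlinarith [sq_nonneg s])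
  have hs : |s| ≤ 1 := (sq_le_one_iff_abs_le_one s).1 (by nlinarith [sq_nonneg c])
  calc |c * p + s * q| ≤ |c| * |p| + |s| * |q| := by
        rw [← abs_mul, ← abs_mul]; exact abs_add_le _ _
    _ ≤ 1 * B + 1 * B := by gcongr
    _ = 2 * B := by ring

lemma abs_pd_lin_le {c t B : ℝ} (h : c ^ 2 + t ^ 2 = 1) (hB : ‖gradient g x‖ ≤ B) :
    |pd (c • stdVec 0 + t • stdVec 1) g x| ≤ 2 * B := by
  have hn := norm_gradient_sq g x
  rw [pd_lin]
  refine abs_lin_le h ?_ ?_ <;> refine le_trans ?_ hB <;>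
    refine abs_le_of_sq_le_sq ?_ (norm_nonneg _) <;> rw [hn]
  · linarith [sq_nonneg (pd (stdVec 1) g x)]
  · linarith [sq_nonneg (pd (stdVec 0) g x)]

lemma abs_pd_pd_lin_le (hg : ContDiffOn ℝ 2 g s) (hs : IsOpen s) (hx : x ∈ s) {c t c' t' B : ℝ}
    (h : c ^ 2 + t ^ 2 = 1) (h' : c' ^ 2 + t' ^ 2 = 1) (hB : hessianNorm g x ≤ B) :
    |pd (c • stdVec 0 + t • stdVec 1) (pd (c' • stdVec 0 + t' • stdVec 1) g) x| ≤ 4 * B := by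
  have hH : ∀ i j, |pd (stdVec i) (pd (stdVec j) g) x| ≤ B := fun i j => by
    rw [← hessian_apply hg hs hx]
    exact (abs_hessian_le g x i j).trans hB
  have e : pd (c • stdVec 0 + t • stdVec 1) (pd (c' • stdVec 0 + t' • stdVec 1) g) x
      = c * (c' * pd (stdVec 0) (pd (stdVec 0) g) x + t' * pd (stdVec 0) (pd (stdVec 1) g) x)
        + t * (c' * pd (stdVec 1) (pd (stdVec 0) g) x
          + t' * pd (stdVec 1) (pd (stdVec 1) g) x) := by
    rw [pd_pd_lin _ _ hg hs hx, pd_comm hg hs (stdVec 1) (stdVec 0) hx]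
    ring
  rw [e]
  refine (abs_lin_le h (abs_lin_le h' (hH 0 0) (hH 0 1)) (abs_lin_le h' (hH 1 0) (hH 1 1))).trans
    (le_of_eq (by ring))

end plane

open Filter Topology

/-- With z = (x + iy)² and h = (P - R)/2 + iQ, the numerator is Im(z̄h), hence at most |z||h|, and
|h|² = (P + R)²/4 - det. The two squares below are (Re z̄h)² and the determinant deficit. -/
lemma twist_sq_le {P Q R x y : ℝ} (hS : 0 < P + R) (hdet : 0 ≤ P * R - Q ^ 2) :
    (((x ^ 2 - y ^ 2) * Q - x * y * (P - R)) / (P + R)) ^ 2 ≤ (x ^ 2 + y ^ 2) ^ 2 / 4 := by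
  rw [div_pow, div_le_iff₀ (by positivity)]
  have h₁ : 0 ≤ ((x ^ 2 - y ^ 2) * ((P - R) / 2) + 2 * (x * y) * Q) ^ 2 := sq_nonneg _
  have h₂ : 0 ≤ (x ^ 2 + y ^ 2) ^ 2 * (P * R - Q ^ 2) := by positivity
  linarith

/-! ### The estimate at an interior maximum -/

section estimate

variable {u f : Plane → ℝ} {R r : ℝ}

/-- The prescribed Gauss curvature equation in coordinates. -/
lemma SolvesGaussCurvatureEq.pd_eq (h : SolvesGaussCurvatureEq u f R)
    (hu : ContDiffOn ℝ 2 u (Metric.ball 0 R)) {x : Plane} (hx : x ∈ Metric.ball (0 : Plane) R) :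
    pd (stdVec 0) (pd (stdVec 0) u) x * pd (stdVec 1) (pd (stdVec 1) u) x
      - pd (stdVec 0) (pd (stdVec 1) u) x ^ 2
      = f x * areaSq (stdVec 0) (stdVec 1) u x ^ 2 := by
  have hx' := h x hx
  have hW : 1 + ‖gradient u x‖ ^ 2 = areaSq (stdVec 0) (stdVec 1) u x := by
    rw [norm_gradient_sq, areaSq]; ring
  rw [← hW, ← hx', div_mul_cancel₀ _ (by positivity), Matrix.det_fin_two]
  simp only [hessian_apply hu Metric.isOpen_ball hx,
    pd_comm hu Metric.isOpen_ball (stdVec 1) (stdVec 0) hx]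
  ring

/-- The equation writes `f` as a quotient of C² functions, so its regularity need not be assumed. -/
lemma SolvesGaussCurvatureEq.contDiffOn (h : SolvesGaussCurvatureEq u f R)
    (hu : ContDiffOn ℝ 4 u (Metric.ball 0 R)) : ContDiffOn ℝ 2 f (Metric.ball 0 R) := by
  have c1 : ∀ v, ContDiffOn ℝ 3 (pd v u) (Metric.ball 0 R) := fun v =>
    hu.pd Metric.isOpen_ball (by norm_num) v
  have c1' : ∀ v, ContDiffOn ℝ 2 (pd v u) (Metric.ball 0 R) := fun v =>
    (c1 v).of_le (by norm_num)
  have c2 : ∀ v w, ContDiffOn ℝ 2 (pd v (pd w u)) (Metric.ball 0 R) := fun v w =>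
    (c1 w).pd Metric.isOpen_ball (by norm_num) v
  have hW : ∀ x, areaSq (stdVec 0) (stdVec 1) u x ^ 2 ≠ 0 := fun x => by
    rw [areaSq]; positivity
  have hWc : ContDiffOn ℝ 2 (areaSq (stdVec 0) (stdVec 1) u) (Metric.ball 0 R) :=
    (contDiffOn_const.add ((c1' _).pow 2)).add ((c1' _).pow 2)
  refine ((((c2 (stdVec 0) (stdVec 0)).mul (c2 (stdVec 1) (stdVec 1))).sub
    ((c2 (stdVec 0) (stdVec 1)).pow 2)).div (hWc.pow 2) fun x _ => hW x).congr fun x hx => ?_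
  rw [Pi.div_apply, eq_div_iff (hW x), ← h.pd_eq (hu.of_le (by norm_num)) hx]

/-- The Laplacian of a convex function with positive Hessian determinant is positive. -/
lemma ConvexOn.lap_pos {V : Type*} [NormedAddCommGroup V] [NormedSpace ℝ V] {s : Set V}
    {u : V → ℝ} {x a b : V} (hc : ConvexOn ℝ s u) (hu : ContDiffOn ℝ 2 u s) (hs : IsOpen s)
    (hx : x ∈ s) (hdet : 0 < pd a (pd a u) x * pd b (pd b u) x - pd a (pd b u) x ^ 2) :
    0 < lap a b u x := by
  have ha := hc.pd_pd_nonneg hu hs hx a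
  have hb := hc.pd_pd_nonneg hu hs hx b
  have hab : 0 < pd a (pd a u) x * pd b (pd b u) x := by
    linarith [sq_nonneg (pd a (pd b u) x)]
  exact add_pos (ha.lt_of_ne fun h => by simp [← h] at hab)
    (hb.lt_of_ne fun h => by simp [← h] at hab)

/-- The squared trace exceeds the squared Frobenius norm by twice the determinant. -/
lemma hessianNorm_le_lap {s : Set Plane} {x : Plane} (hu : ContDiffOn ℝ 2 u s) (hs : IsOpen s)
    (hx : x ∈ s) (hdet : 0 ≤ pd (stdVec 0) (pd (stdVec 0) u) x * pd (stdVec 1) (pd (stdVec 1) u) x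
      - pd (stdVec 0) (pd (stdVec 1) u) x ^ 2) (hlap : 0 ≤ lap (stdVec 0) (stdVec 1) u x) :
    hessianNorm u x ≤ lap (stdVec 0) (stdVec 1) u x := by
  refine Real.sqrt_le_iff.2 ⟨hlap, ?_⟩
  simp only [Fin.sum_univ_two, hessian_apply hu hs hx, lap, pd_comm hu hs (stdVec 1) (stdVec 0) hx]
  linarith

/-- The bound at an interior maximum of the test function, in the standard frame. -/
theorem exists_bound_at_max (m M R K₁ K₂ L r : ℝ) (hm : 0 < m) (hr : 0 < r) :
    ∃ K, 0 < K ∧ ∃ T, 0 < T ∧ ∀ u f : Plane → ℝ,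
      ContDiffOn ℝ 4 u (Metric.ball 0 R) → ConvexOn ℝ (Metric.ball 0 R) u →
      SolvesGaussCurvatureEq u f R →
      (∀ x ∈ Metric.ball (0 : Plane) R, m ≤ f x ∧ f x ≤ M) →
      (∀ x ∈ Metric.ball (0 : Plane) R, ‖gradient f x‖ ≤ K₁) →
      (∀ x ∈ Metric.ball (0 : Plane) R, hessianNorm f x ≤ K₂) →
      (∀ x ∈ Metric.ball (0 : Plane) R, ‖gradient u x‖ ≤ L) →
      ∀ x ∈ Metric.ball (0 : Plane) R, ‖x‖ ^ 2 ≤ 2 * r ^ 2 →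
      0 < cutoff r (stdVec 0) (stdVec 1) (stdCoord 0) (stdCoord 1) u x →
      IsLocalMax (testFn r K (stdVec 0) (stdVec 1) (stdCoord 0) (stdCoord 1) u) x →
      lap (stdVec 0) (stdVec 1) u x
          * cutoff r (stdVec 0) (stdVec 1) (stdCoord 0) (stdCoord 1) u x ≤ 2 * T ∧
        cutoff r (stdVec 0) (stdVec 1) (stdCoord 0) (stdCoord 1) u x ≤ r ^ 4 := by
  obtain ⟨K, hK, T, hT, H⟩ :=
    -- The factors 2 and 4 are crude bounds for first and second derivatives along rotated unit
    -- vectors.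
    CritJet.exists_bound (2 * |R| + 2 * |L| + |M| + 2 * |K₁| + 4 * |K₂|) m r hm hr
  refine ⟨K, hK, T, hT, fun u f hu hc heq hfb hf₁ hf₂ hL x hx hxr hη hmax => ?_⟩
  have hs : IsOpen (Metric.ball (0 : Plane) R) := Metric.isOpen_ball
  have hu2 : ContDiffOn ℝ 2 u (Metric.ball 0 R) := hu.of_le (by norm_num)
  have hf := heq.contDiffOn hu
  -- The frame diagonalises the Hessian at `x` alone and is then kept constant, so its vectors are
  -- never differentiated; invariance carries the local maximum over to it.
  obtain ⟨c, s, hcs, hdiag, hle⟩ := exists_diagonalising_rotation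
    (pd (stdVec 0) (pd (stdVec 0) u) x) (pd (stdVec 0) (pd (stdVec 1) u) x)
    (pd (stdVec 1) (pd (stdVec 1) u) x)
  have hcs' : (-s) ^ 2 + c ^ 2 = 1 := by linarith
  set e₁ : Plane := c • stdVec 0 + s • stdVec 1 with he₁
  set e₂ : Plane := -s • stdVec 0 + c • stdVec 1 with he₂
  set l₁ : Plane →L[ℝ] ℝ := c • stdCoord 0 + s • stdCoord 1 with hl₁
  set l₂ : Plane →L[ℝ] ℝ := -s • stdCoord 0 + c • stdCoord 1 with hl₂
  have heq' : ∀ y ∈ Metric.ball (0 : Plane) R,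
      pd e₁ (pd e₁ u) y * pd e₂ (pd e₂ u) y - pd e₁ (pd e₂ u) y ^ 2
        = f y * areaSq e₁ e₂ u y ^ 2 := fun y hy => by
    rw [he₁, he₂, det_rotate _ _ hu2 hs hy hcs, areaSq_rotate _ _ hcs, heq.pd_eq hu2 hy]
  have hB : pd e₁ (pd e₂ u) x = 0 := by
    rw [he₁, he₂, pd_pd_lin _ _ hu2 hs hx]; linear_combination hdiag
  have hDA : pd e₂ (pd e₂ u) x ≤ pd e₁ (pd e₁ u) x := by
    rw [he₁, he₂, pd_pd_lin _ _ hu2 hs hx, pd_pd_lin _ _ hu2 hs hx]; linarith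
  have hdet : 0 < pd e₁ (pd e₁ u) x * pd e₂ (pd e₂ u) x := by
    have h := heq' x hx
    rw [hB] at h
    have hpos : 0 < f x * areaSq e₁ e₂ u x ^ 2 :=
      mul_pos (hm.trans_le (hfb x hx).1) (by rw [areaSq]; positivity)
    linarith
  have hD : 0 < pd e₂ (pd e₂ u) x :=
    (hc.pd_pd_nonneg hu2 hs hx e₂).lt_of_ne fun h => by simp [← h] at hdet
  have hA : 0 < pd e₁ (pd e₁ u) x := hD.trans_le hDA
  have hcut := cutoff_rotate (stdVec 0) (stdVec 1) (stdCoord 0) (stdCoord 1) r hu2 hs hx hcs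
  have hlap := lap_rotate (stdVec 0) (stdVec 1) hu2 hs hx hcs
  have hmax' : IsLocalMax (testFn r K e₁ e₂ l₁ l₂ u) x := by
    filter_upwards [hmax, hs.mem_nhds hx] with y hy hyR
    rw [he₁, he₂, hl₁, hl₂, testFn_rotate _ _ _ _ r K hu2 hs hyR hcs,
      testFn_rotate _ _ _ _ r K hu2 hs hx hcs]
    exact hy
  obtain ⟨J, hJx₁, hJx₂, hJu₁, hJu₂, hJA, hJf, hJf₁, hJf₂, hJf₁₁, hJf₁₂, hJf₂₂, hJη⟩ :=
    exists_critJet (r := r) (K := K) (e₁ := e₁) (e₂ := e₂) (l₁ := l₁) (l₂ := l₂) hs hx hu hf heq'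
      (by simp [hl₁, he₁]; linarith) (by simp [hl₁, he₂]; ring) (by simp [hl₂, he₁]; ring)
      (by simp [hl₂, he₂]; linarith) hB hA hD (by rw [hcut]; exact hη) hmax'
  have hnorm : l₁ x ^ 2 + l₂ x ^ 2 = ‖x‖ ^ 2 := by
    rw [← sum_sq_stdCoord, hl₁, hl₂]
    simp only [add_apply, smul_apply, smul_eq_mul]
    linear_combination (stdCoord 0 x ^ 2 + stdCoord 1 x ^ 2) * hcs
  have hxR : ‖x‖ ≤ |R| := (mem_ball_zero_iff.1 hx).le.trans (le_abs_self R)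
  have aR := abs_nonneg R
  have aL := abs_nonneg L
  have aM := abs_nonneg M
  have a₁ := abs_nonneg K₁
  have a₂ := abs_nonneg K₂
  have hLx := (hL x hx).trans (le_abs_self L)
  have hf₁x := (hf₁ x hx).trans (le_abs_self K₁)
  have hf₂x := (hf₂ x hx).trans (le_abs_self K₂)
  have hJ : J.Bounds (2 * |R| + 2 * |L| + |M| + 2 * |K₁| + 4 * |K₂|) m :=
    { x₁ := by
        rw [hJx₁]
        have : |l₁ x| ≤ ‖x‖ := abs_le_of_sq_le_sq (by linarith [sq_nonneg (l₂ x)]) (norm_nonneg _)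
        linarith
      x₂ := by
        rw [hJx₂]
        have : |l₂ x| ≤ ‖x‖ := abs_le_of_sq_le_sq (by linarith [sq_nonneg (l₁ x)]) (norm_nonneg _)
        linarith
      u₁ := by
        rw [hJu₁]
        linarith [abs_pd_lin_le hcs hLx]
      u₂ := by
        rw [hJu₂]
        linarith [abs_pd_lin_le hcs' hLx]
      f := by
        rw [hJf, abs_of_pos (hm.trans_le (hfb x hx).1)]
        linarith [(hfb x hx).2, le_abs_self M]
      f₁ := by
        rw [hJf₁]
        linarith [abs_pd_lin_le hcs hf₁x]
      f₂ := by
        rw [hJf₂]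
        linarith [abs_pd_lin_le hcs' hf₁x]
      f₁₁ := by
        rw [hJf₁₁]
        linarith [abs_pd_pd_lin_le hf hs hx hcs hcs hf₂x]
      f₁₂ := by
        rw [hJf₁₂]
        linarith [abs_pd_pd_lin_le hf hs hx hcs hcs' hf₂x]
      f₂₂ := by
        rw [hJf₂₂]
        linarith [abs_pd_pd_lin_le hf hs hx hcs' hcs' hf₂x]
      le_f := by
        rw [hJf]
        exact (hfb x hx).1 }
  have hJr : J.x₁ ^ 2 + J.x₂ ^ 2 ≤ 2 * r ^ 2 := by
    rw [hJx₁, hJx₂, hnorm]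
    exact hxr
  rw [hcut] at hJη
  have hb := H J hJ hJr (by rw [hJη]; exact hη)
  rw [hJη, hJA] at hb
  refine ⟨?_, hJη ▸ J.η_le hJr⟩
  rw [← hlap]
  -- The factor 2 in the conclusion: the trace is at most twice the larger eigenvalue.
  have h2 : lap e₁ e₂ u x ≤ 2 * pd e₁ (pd e₁ u) x := by rw [lap]; linarith
  have := mul_le_mul_of_nonneg_right h2 hη.le
  linarith

end estimate

/-! ### Comparison of the origin with the maximum point -/

theorem theorem1p1 (m M R K₁ K₂ L : ℝ) (hm : 0 < m) (hR : 0 < R) :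
    ∃ C : ℝ, 0 < C ∧
      ∀ u f : EuclideanSpace ℝ (Fin 2) → ℝ,
        ContDiffOn ℝ 4 u (Metric.ball 0 R) →
        ConvexOn ℝ (Metric.ball 0 R) u →
        SolvesGaussCurvatureEq u f R →
        (∀ x ∈ Metric.ball (0 : EuclideanSpace ℝ (Fin 2)) R, m ≤ f x ∧ f x ≤ M) →
        (∀ x ∈ Metric.ball (0 : EuclideanSpace ℝ (Fin 2)) R, ‖gradient f x‖ ≤ K₁) →
        (∀ x ∈ Metric.ball (0 : EuclideanSpace ℝ (Fin 2)) R, hessianNorm f x ≤ K₂) →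
        (∀ x ∈ Metric.ball (0 : EuclideanSpace ℝ (Fin 2)) R, ‖gradient u x‖ ≤ L) →
        hessianNorm u 0 ≤ C := by
  -- The cutoff lives on the disc of radius `√2 r`, which must lie strictly inside the given one.
  set r := R / 2 with hrR
  have hr : 0 < r := by positivity
  obtain ⟨K, hK, T, hT, H⟩ := exists_bound_at_max m M R K₁ K₂ L r hm hr
  refine ⟨2 * T * Real.exp (K / 2 * (1 + L ^ 2)) / r ^ 4, by positivity,
    fun u f hu hc heq hfb hf₁ hf₂ hL => ?_⟩
  have hs : IsOpen (Metric.ball (0 : Plane) R) := Metric.isOpen_ball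
  have hu2 : ContDiffOn ℝ 2 u (Metric.ball 0 R) := hu.of_le (by norm_num)
  have c1 : ∀ v, ContinuousOn (pd v u) (Metric.ball 0 R) := fun v =>
    (hu.pd hs (m := 3) (by norm_num) v).continuousOn
  have c2 : ∀ v w, ContinuousOn (pd v (pd w u)) (Metric.ball 0 R) := fun v w =>
    ((hu.pd hs (m := 3) (by norm_num) w).pd hs (m := 2) (by norm_num) v).continuousOn
  have hdet : ∀ x ∈ Metric.ball (0 : Plane) R,
      0 < pd (stdVec 0) (pd (stdVec 0) u) x * pd (stdVec 1) (pd (stdVec 1) u) x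
        - pd (stdVec 0) (pd (stdVec 1) u) x ^ 2 := fun x hx => by
    rw [heq.pd_eq hu2 hx]
    exact mul_pos (hm.trans_le (hfb x hx).1) (by rw [areaSq]; positivity)
  have hSpos : ∀ x ∈ Metric.ball (0 : Plane) R, 0 < lap (stdVec 0) (stdVec 1) u x := fun x hx =>
    hc.lap_pos hu2 hs hx (hdet x hx)
  set S : Plane → ℝ := lap (stdVec 0) (stdVec 1) u with hSdef
  set W : Plane → ℝ := areaSq (stdVec 0) (stdVec 1) u with hWdef
  set η : Plane → ℝ := cutoff r (stdVec 0) (stdVec 1) (stdCoord 0) (stdCoord 1) u with hηdef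
  have cS : ContinuousOn S (Metric.ball 0 R) := (c2 _ _).add (c2 _ _)
  have cW : ContinuousOn W (Metric.ball 0 R) :=
    (continuousOn_const.add ((c1 _).pow 2)).add ((c1 _).pow 2)
  have cl : ∀ i, ContinuousOn (fun x : Plane => stdCoord i x) (Metric.ball 0 R) := fun i =>
    (stdCoord i).continuous.continuousOn
  have cη : ContinuousOn η (Metric.ball 0 R) :=
    (continuousOn_const.sub (continuousOn_const.mul (((cl 0).pow 2).add ((cl 1).pow 2)))).add
      ((((((cl 0).pow 2).sub ((cl 1).pow 2)).mul (c2 _ _)).sub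
        (((cl 0).mul (cl 1)).mul ((c2 _ _).sub (c2 _ _)))).div cS
          (fun x hx => (hSpos x hx).ne') |>.pow 2)
  -- maximise the test function over a closed disc
  set G : Plane → ℝ := fun x => S x * max (η x) 0 ^ 8 * Real.exp (K / 2 * W x) with hG
  have cG : ContinuousOn G (Metric.ball 0 R) :=
    (cS.mul ((cη.sup continuousOn_const).pow 8)).mul
      (Real.continuous_exp.comp_continuousOn (continuousOn_const.mul cW))
  set q := Real.sqrt 2 * r with hq
  have hq0 : 0 < q := by positivity
  have hq2 : q ^ 2 = 2 * r ^ 2 := by rw [hq, mul_pow, Real.sq_sqrt (by norm_num)]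
  have hqR : q < R := lt_of_pow_lt_pow_left₀ 2 hR.le (by
    rw [hq2, hrR]
    have : 0 < R ^ 2 := by positivity
    linarith)
  have hsub : Metric.closedBall (0 : Plane) q ⊆ Metric.ball 0 R :=
    Metric.closedBall_subset_ball hqR
  have h0q : (0 : Plane) ∈ Metric.closedBall (0 : Plane) q := Metric.mem_closedBall_self hq0.le
  have h0R : (0 : Plane) ∈ Metric.ball (0 : Plane) R := Metric.mem_ball_self hR
  obtain ⟨x, hxq, hxmax⟩ := (isCompact_closedBall (0 : Plane) q).exists_isMaxOn ⟨0, h0q⟩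
    (cG.mono hsub)
  have hxR := hsub hxq
  have hη0 : η 0 = r ^ 4 := by
    simp [hηdef, cutoff, twist]
  have hG0 : S 0 * (r ^ 4) ^ 8 ≤ G 0 := by
    simp only [hG, hη0]
    rw [max_eq_left (by positivity)]
    have hW0 : 0 ≤ W 0 := by simp only [hWdef, areaSq]; positivity
    have h1 : 1 ≤ Real.exp (K / 2 * W 0) := Real.one_le_exp (by positivity)
    have h2 := hSpos 0 h0R
    exact le_mul_of_one_le_right (by positivity) h1
  have hG0x : G 0 ≤ G x := hxmax h0q
  -- Truncation makes `G` vanish wherever `η ≤ 0`, while `G 0 > 0`; this also keeps the maximum in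
  -- the domain of the logarithmic test function.
  have hηx : 0 < η x := by
    by_contra h
    have hz : G x = 0 := by simp [hG, max_eq_right (not_lt.1 h)]
    have := hSpos 0 h0R
    have : 0 < S 0 * (r ^ 4) ^ 8 := by positivity
    linarith
  -- On the bounding circle the twist bound gives `η ≤ r⁴ - 2r⁴ + r⁴ = 0`.
  have hxlt : ‖x‖ < q := by
    refine lt_of_le_of_ne (mem_closedBall_zero_iff.1 hxq) fun h => ?_
    have ht := twist_sq_le (x := stdCoord 0 x) (y := stdCoord 1 x) (hSpos x hxR) (hdet x hxR).le
    rw [sum_sq_stdCoord, h, hq2] at ht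
    have hle : η x ≤ r ^ 4 - r ^ 2 * (2 * r ^ 2) + (2 * r ^ 2) ^ 2 / 4 := by
      have : η x = r ^ 4 - r ^ 2 * (stdCoord 0 x ^ 2 + stdCoord 1 x ^ 2)
        + twist (stdVec 0) (stdVec 1) (stdCoord 0) (stdCoord 1) u x ^ 2 := rfl
      rw [this, sum_sq_stdCoord, h, hq2]
      exact add_le_add_right ht _
    have : r ^ 4 - r ^ 2 * (2 * r ^ 2) + (2 * r ^ 2) ^ 2 / 4 = 0 := by ring
    linarith
  have hlog : ∀ y ∈ Metric.ball (0 : Plane) R, 0 < η y → Real.log (G y)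
      = testFn r K (stdVec 0) (stdVec 1) (stdCoord 0) (stdCoord 1) u y := fun y hy hηy => by
    have := (hSpos y hy).ne'
    simp only [hG, max_eq_left hηy.le, testFn]
    rw [Real.log_mul (mul_ne_zero this (pow_ne_zero 8 hηy.ne')) (Real.exp_ne_zero _),
      Real.log_mul this (pow_ne_zero 8 hηy.ne'), Real.log_exp, Real.log_pow]
    norm_num
    rfl
  have hGpos : ∀ y ∈ Metric.ball (0 : Plane) R, 0 < η y → 0 < G y := fun y hy hηy => by
    have := hSpos y hy
    have : 0 < max (η y) 0 := lt_max_of_lt_left hηy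
    simp only [hG]
    positivity
  have hloc : IsLocalMax (testFn r K (stdVec 0) (stdVec 1) (stdCoord 0) (stdCoord 1) u) x := by
    have hev : ∀ᶠ y in 𝓝 x, 0 < η y :=
      (cη.continuousAt (hs.mem_nhds hxR)).eventually (lt_mem_nhds hηx)
    filter_upwards [hev, Metric.isOpen_ball.mem_nhds (mem_ball_zero_iff.2 hxlt)] with y hy hyq
    have hyq' := Metric.ball_subset_closedBall hyq
    rw [← hlog y (hsub hyq') hy, ← hlog x hxR hηx]
    exact Real.log_le_log (hGpos y (hsub hyq') hy) (hxmax hyq')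
  have hxr : ‖x‖ ^ 2 ≤ 2 * r ^ 2 := by
    rw [← hq2]
    exact pow_le_pow_left₀ (norm_nonneg _) hxlt.le 2
  obtain ⟨hb₁, hb₂⟩ := H u f hu hc heq hfb hf₁ hf₂ hL x hxR hxr hηx hloc
  have hWx : W x ≤ 1 + L ^ 2 := by
    have h1 : W x = 1 + ‖gradient u x‖ ^ 2 := by
      rw [norm_gradient_sq, hWdef, areaSq]; ring
    rw [h1]
    exact add_le_add_right (pow_le_pow_left₀ (norm_nonneg _) (hL x hxR) 2) 1
  -- One factor `η` is spent on the bound for `S η`; the other seven are bounded by `r⁴` and cancel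
  -- against `η(0)⁸ = (r⁴)⁸`.
  have hGx : G x ≤ 2 * T * (r ^ 4) ^ 7 * Real.exp (K / 2 * (1 + L ^ 2)) := by
    simp only [hG, max_eq_left hηx.le]
    have e : S x * η x ^ 8 = S x * η x * η x ^ 7 := by ring
    rw [e]
    gcongr
  refine (hessianNorm_le_lap hu2 hs h0R (hdet 0 h0R).le (hSpos 0 h0R).le).trans ?_
  rw [le_div_iff₀ (by positivity)]
  have hfin : S 0 * r ^ 4 * (r ^ 4) ^ 7
      ≤ 2 * T * Real.exp (K / 2 * (1 + L ^ 2)) * (r ^ 4) ^ 7 := by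
    have := hG0.trans (hG0x.trans hGx)
    linarith
  exact le_of_mul_le_mul_right hfin (by positivity)
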